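/- Consider the linear instrumental variables model with one endogenous variable: for sample sizes $n=1,2,\dots$, let $y = X\beta_0+\varepsilon\in\mathbb R^n$ and $X = Z\Pi+V\in\mathbb R^n$, with random $Z\in\mathbb R^{n\times k}$ and $\varepsilon,V\in\mathbb R^n$ (all depending on $n$), fixed $k$ and $\beta_0\in\mathbb R$, and weak instruments: $\sqrt n\,\Pi=\Pi_0\in\mathbb R^k$ is fixed (independent of $n$) and $\Pi_0\neq0$. Assume that there are positive definite $\Omega\in\mathbb R^{2\times2}$ and $Q\in\mathbb R^{k\times k}$ such that, as $n\to\infty$, (a) $\frac1n(\varepsilon\ V)^T(\varepsilon\ V)\to\Omega$ in probability; (b) with $\Psi:=(Z^TZ)^{-1/2}Z^T(\varepsilon\ V)\in\mathbb R^{k\times2}$, $\operatorname{vec}(\Psi)\to\mathcal N(0,\Omega\otimes\mathrm{Id}_k)$ in distribution; (c) $\frac1nZ^TZ\to Q$ in probability. Let $P_Z=Z(Z^TZ)^{-1}Z^T$, $M_Z=\mathrm{Id}_n-P_Z$, $$\mathrm{LR}(\beta)=(n-k)\frac{(y-X\beta)^TP_Z(y-X\beta)}{(y-X\beta)^TM_Z(y-X\beta)}-(n-k)\inf_{b\in\mathbb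 R}\frac{(y-Xb)^TP_Z(y-Xb)}{(y-Xb)^TM_Z(y-Xb)},$$ $$\tilde X=X-\varepsilon\,\frac{\varepsilon^TM_ZX}{\varepsilon^TM_Z\varepsilon},\qquad \lambda_1=(n-k)\,[\tilde X^TM_Z\tilde X]^{-1}\tilde X^TP_Z\tilde X .$$ Let $q_0\sim\chi^2(k-1)$ and $q_1\sim\chi^2(1)$ be independent (where $\chi^2(0)$ is the point mass at $0$), and for $l\in\mathbb R$ put $$\Gamma(l)=\tfrac12\Big(q_0+q_1-l+\sqrt{(q_0+q_1+l)^2-4q_0l}\Big).$$ Then, conditionally on $\lambda_1$, $\mathrm{LR}(\beta_0)$ converges in distribution to $\Gamma(\lambda_1)$ as $n\to\infty$, in the following sense. (i) There is a real random variable $\lambda_\infty$, independent of $(q_0,q_1)$, such that $(\lambda_1,\mathrm{LR}(\beta_0))\to(\lambda_\infty,\Gamma(\lambda_\infty))$ jointly in distribution. (ii) For every $l_0\ge0$, every bounded continuous $f:\mathbb R\to\mathbb R$ and every $\eta>0$ there is $\delta_0>0$ such that for every $\delta\in(0,\delta_0)$ and all sufficiently large $n$ (depending on $\delta$), $\mathbb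 P(|\lambda_1-l_0|<\delta)>0$ and $$\Big|\mathbb E\big[f(\mathrm{LR}(\beta_0))\,\big|\,|\lambda_1-l_0|<\delta\big]-\mathbb E\big[f(\Gamma(l_0))\big]\Big|<\eta .$$ -/

import Mathlib

open MeasureTheory ProbabilityTheory Filter Topology Matrix
open scoped Kronecker BoundedContinuousFunction

noncomputable section

/-- The chi-squared distribution with `d` degrees of freedom: the law of the sum of the squares
of `d` independent standard normal variables (the point mass at `0` if `d = 0`). -/
def chiSquared (d : ℕ) : Measure ℝ :=
  (Measure.pi fun _ : Fin d => gaussianReal 0 1).map fun x => ∑ i, x i ^ 2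

instance (d : ℕ) : IsProbabilityMeasure (chiSquared d) :=
  Measure.isProbabilityMeasure_map
    (Finset.measurable_sum _ fun i _ => (measurable_pi_apply i).pow_const 2).aemeasurable

/-- The projection `P_Z = Z (ZᵀZ)⁻¹ Zᵀ` onto the column space of `Z`. -/
def projZ {n k : ℕ} (Z : Matrix (Fin n) (Fin k) ℝ) : Matrix (Fin n) (Fin n) ℝ :=
  Z * (Zᵀ * Z)⁻¹ * Zᵀ

/-- The annihilator `M_Z = Id - P_Z`. -/
def annZ {n k : ℕ} (Z : Matrix (Fin n) (Fin k) ℝ) : Matrix (Fin n) (Fin n) ℝ :=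
  1 - projZ Z

/-- The (symmetric) inverse square root `A^(-1/2)` of a positive definite matrix `A`. -/
def invSqrt {k : ℕ} (A : Matrix (Fin k) (Fin k) ℝ) : Matrix (Fin k) (Fin k) ℝ :=
  cfc (fun x : ℝ => (Real.sqrt x)⁻¹) A

/-- The `n × 2` matrix `(ε V)` of errors. -/
def errorMatrix {n : ℕ} (ε V : Fin n → ℝ) : Matrix (Fin n) (Fin 2) ℝ :=
  Matrix.of fun i => ![ε i, V i]

/-- `Ψ = (ZᵀZ)^(-1/2) Zᵀ (ε V)`. -/
def psiMatrix {n k : ℕ} (Z : Matrix (Fin n) (Fin k) ℝ) (ε V : Fin n → ℝ) :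
    Matrix (Fin k) (Fin 2) ℝ :=
  invSqrt (Zᵀ * Z) * Zᵀ * errorMatrix ε V

/-- The Anderson-Rubin type ratio
`(y - X b)ᵀ P_Z (y - X b) / (y - X b)ᵀ M_Z (y - X b)`. -/
def arRatio {n k : ℕ} (Z : Matrix (Fin n) (Fin k) ℝ) (X y : Fin n → ℝ) (b : ℝ) : ℝ :=
  ((y - b • X) ⬝ᵥ projZ Z *ᵥ (y - b • X)) / ((y - b • X) ⬝ᵥ annZ Z *ᵥ (y - b • X))

/-- The likelihood-ratio statistic `LR(β)`. -/
def lrStat {n k : ℕ} (Z : Matrix (Fin n) (Fin k) ℝ) (X y : Fin n → ℝ) (β : ℝ) : ℝ :=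
  ((n : ℝ) - k) * arRatio Z X y β - ((n : ℝ) - k) * ⨅ b : ℝ, arRatio Z X y b

/-- `X̃(β) = X - (y - X β) ((y - X β)ᵀ M_Z X) / ((y - X β)ᵀ M_Z (y - X β))`. -/
def tildeX {n k : ℕ} (Z : Matrix (Fin n) (Fin k) ℝ) (X y : Fin n → ℝ) (β : ℝ) : Fin n → ℝ :=
  X - (((y - β • X) ⬝ᵥ annZ Z *ᵥ X) / ((y - β • X) ⬝ᵥ annZ Z *ᵥ (y - β • X))) • (y - β • X)

/-- The conditioning statistic `λ₁ = (n - k) [X̃(β)ᵀ M_Z X̃(β)]⁻¹ X̃(β)ᵀ P_Z X̃(β)`. -/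
def lambdaStat {n k : ℕ} (Z : Matrix (Fin n) (Fin k) ℝ) (X y : Fin n → ℝ) (β : ℝ) : ℝ :=
  ((n : ℝ) - k) * (tildeX Z X y β ⬝ᵥ annZ Z *ᵥ tildeX Z X y β)⁻¹ *
    (tildeX Z X y β ⬝ᵥ projZ Z *ᵥ tildeX Z X y β)

/-- `½ (q₀ + q₁ - l + √((q₀ + q₁ + l)² - 4 q₀ l))`. -/
def gammaFun (l q₀ q₁ : ℝ) : ℝ :=
  (1 / 2) * (q₀ + q₁ - l + Real.sqrt ((q₀ + q₁ + l) ^ 2 - 4 * q₀ * l))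

/-- The sequence `T n` converges in distribution, conditionally on the (`n`-dependent)
nonnegative statistic `L n`, to `G (L n) Q`, where `Q ∼ ρ` is independent of the conditioning
variable. This asks for two things.

* Jointly, `(L n, T n)` converges in distribution to `(l, G l Q)`, where `l ∼ ν` is independent of
  `Q ∼ ρ`: in the limit, the conditional law of the second coordinate given `l` is that of `G l Q`.
* For each fixed value `l₀ ≥ 0`, the law of `T n` given that `L n` lies in a small window around
  `l₀` (an event of positive probability for large `n`) converges weakly to the law of `G l₀ Q`,
  as `n → ∞` and then the width of the window tends to `0`. -/
def TendstoInDistributionGiven {Ω E : Type*} [MeasurableSpace Ω] [MeasurableSpace E]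
    (P : Measure Ω) [IsProbabilityMeasure P] (T L : ℕ → Ω → ℝ)
    (G : ℝ → E → ℝ) (ρ : Measure E) [IsProbabilityMeasure ρ] : Prop :=
  (∃ (ν : Measure ℝ) (_ : IsProbabilityMeasure ν),
    TendstoInDistribution (fun n ω => (L n ω, T n ω)) atTop
      (fun p : ℝ × E => (p.1, G p.1 p.2)) (fun _ => P) (ν.prod ρ)) ∧
  ∀ l₀ : ℝ, 0 ≤ l₀ → ∀ f : ℝ →ᵇ ℝ, ∀ η : ℝ, 0 < η →
    ∃ δ₀ : ℝ, 0 < δ₀ ∧ ∀ δ : ℝ, 0 < δ → δ < δ₀ → ∀ᶠ n in atTop,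
      0 < P {ω | |L n ω - l₀| < δ} ∧
      |∫ ω, f (T n ω) ∂(P[|{ω | |L n ω - l₀| < δ}]) - ∫ q, f (G l₀ q) ∂ρ| < η

end

/-! Both statistics depend on the data only through the quadratic forms of `P_Z` and `M_Z` on the
span of ε and X. The infimum in LR is the smaller generalized eigenvalue of this pair of forms, so
LR is an explicit root of a quadratic equation (`iInf_ratio_eq`, `lrStat_eq`), and λ₁ is a ratio of
entries obtained after regressing X on ε in the residual form (`lambdaStat_eq`). Since (ZᵀZ)^(-1/2)
Zᵀ X is (ZᵀZ/n)^(1/2) Π₀ plus the second column of Ψ, the pair is a function of the state (Ψ, error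
moments, ZᵀZ/n, 1/n), continuous on an open set that contains every limit state. Slutsky's theorem
gives joint convergence of the state, and the continuous mapping theorem gives that of the pair.

In the limit, a Cholesky factor of Ω writes the columns of Ψ as αx and rαx + σz with x, z
independent standard normal vectors. The regression removes rαx. With m = σ⁻¹ Q^(1/2) Π₀ the limits
are λ = |m + z|² and the larger root t of t (t - (|x|² - λ)) = (x·(m + z))². For fixed z, rotation
invariance splits |x|² into q₁, the part along m + z, and an independent rest q₀. Then (x·(m + z))²
= λ q₁ and the root is Γ(λ). The law of (q₀, q₁) is the same for every direction, hence independent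
of z (`map_prod_stdNormalPi_upperRoot`).

For the conditional statement, λ is noncentral chi-squared: it has no atoms and charges every
neighbourhood of every l₀ ≥ 0. So the window events have null boundary and positive limiting
probability, and the conditional expectations converge to the average over the window of the
continuous function l ↦ E f(Γ(l)). -/

/-! ### Weak convergence and conditioning on small windows -/

/-- **Continuous mapping theorem** for a map continuous on an open set that supports the limit. -/
theorem tendstoInDistribution_of_continuousOn {Ω Ω' E E' : Type*} [MeasurableSpace Ω]
    [MeasurableSpace Ω'] [TopologicalSpace E] [MeasurableSpace E] [OpensMeasurableSpace E]
    [HasOuterApproxClosed E]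
    [TopologicalSpace E'] [MeasurableSpace E'] [OpensMeasurableSpace E']
    {P : Measure Ω} [IsProbabilityMeasure P] {P' : Measure Ω'} [IsProbabilityMeasure P']
    {X : ℕ → Ω → E} {X' : Ω' → E} {Y : ℕ → Ω → E'} {Y' : Ω' → E'}
    (hX : TendstoInDistribution X atTop X' (fun _ => P) P')
    (hY : ∀ n, AEMeasurable (Y n) P) (hY' : AEMeasurable Y' P')
    (F : E → E') {U : Set E} (hU : IsOpen U) (hF : ContinuousOn F U)
    (hX'U : ∀ᵐ ω ∂P', X' ω ∈ U) (hY'F : ∀ ω, X' ω ∈ U → Y' ω = F (X' ω))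
    (hYF : ∀ᶠ n in atTop, ∀ ω, X n ω ∈ U → Y n ω = F (X n ω)) :
    TendstoInDistribution Y atTop Y' (fun _ => P) P' where
  forall_aemeasurable := hY
  aemeasurable_limit := hY'
  tendsto := by
    refine tendsto_of_forall_isOpen_le_liminf' fun G hG => ?_
    -- Portmanteau on open sets gives a lower bound, so the mass of `X n` outside `U` may simply be
    -- discarded.
    have hV : IsOpen (U ∩ F ⁻¹' G) := hF.isOpen_inter_preimage hU hG
    have h1 := ProbabilityMeasure.le_liminf_measure_open_of_tendsto hX.tendsto hV
    simp only [ProbabilityMeasure.coe_mk] at h1 ⊢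
    calc P'.map Y' G ≤ P'.map X' (U ∩ F ⁻¹' G) := by
          rw [Measure.map_apply_of_aemeasurable hY' hG.measurableSet,
            Measure.map_apply_of_aemeasurable hX.aemeasurable_limit hV.measurableSet]
          refine measure_mono_ae ?_
          filter_upwards [hX'U] with ω hω hG'
          refine ⟨hω, ?_⟩
          have : Y' ω ∈ G := hG'
          rw [hY'F ω hω] at this
          exact this
      _ ≤ _ := h1
      _ ≤ _ := by
          refine liminf_le_liminf ?_
          filter_upwards [hYF] with n hn
          rw [Measure.map_apply_of_aemeasurable (hY n) hG.measurableSet,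
            Measure.map_apply_of_aemeasurable (hX.forall_aemeasurable n) hV.measurableSet]
          refine measure_mono fun ω hω => ?_
          have : F (X n ω) ∈ G := hω.2
          rw [← hn ω hω.1] at this
          exact this

/-- Uniformly bounded variables converging in distribution have converging expectations. -/
theorem MeasureTheory.TendstoInDistribution.tendsto_integral_of_abs_le {Ω Ω' : Type*}
    [MeasurableSpace Ω] [MeasurableSpace Ω']
    {P : Measure Ω} [IsProbabilityMeasure P] {P' : Measure Ω'} [IsProbabilityMeasure P']
    {Y : ℕ → Ω → ℝ} {Y' : Ω' → ℝ} (h : TendstoInDistribution Y atTop Y' (fun _ => P) P')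
    {C : ℝ} (hY : ∀ n ω, |Y n ω| ≤ C) (hY' : ∀ ω, |Y' ω| ≤ C) :
    Tendsto (fun n => ∫ ω, Y n ω ∂P) atTop (𝓝 (∫ ω, Y' ω ∂P')) := by
  -- Clipping at ±|C| makes the identity a bounded test function without changing the variables.
  let g : ℝ →ᵇ ℝ := BoundedContinuousFunction.ofNormedAddCommGroup
    (fun x => max (-|C|) (min |C| x)) (by fun_prop) |C| (fun x => by
      rw [Real.norm_eq_abs, abs_le]
      exact ⟨le_max_left _ _, max_le (by linarith [abs_nonneg C]) (min_le_left _ _)⟩)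
  have hg : ∀ x, |x| ≤ C → g x = x := fun x hx => by
    have hx' := abs_le.1 (hx.trans (le_abs_self C))
    change max (-|C|) (min |C| x) = x
    rw [min_eq_right hx'.2, max_eq_right hx'.1]
  have h1 := (ProbabilityMeasure.tendsto_iff_forall_integral_tendsto.1 h.tendsto) g
  simp only [ProbabilityMeasure.coe_mk] at h1
  rw [integral_map h.aemeasurable_limit g.continuous.aestronglyMeasurable] at h1
  simp_rw [integral_map (h.forall_aemeasurable _) g.continuous.aestronglyMeasurable] at h1
  simpa only [hg _ (hY _ _), hg _ (hY' _)] using h1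

/-- Joint convergence in distribution to `(l, G l Q)` with `l` atomless and charging every
neighbourhood of every `l₀ ≥ 0` gives conditional convergence in distribution. -/
theorem tendstoInDistributionGiven_of_joint {Ω E : Type*} [MeasurableSpace Ω]
    [TopologicalSpace E] [MeasurableSpace E] [OpensMeasurableSpace E]
    {P : Measure Ω} [IsProbabilityMeasure P] {T L : ℕ → Ω → ℝ}
    (hL : ∀ n, Measurable (L n)) (hT : ∀ n, Measurable (T n))
    {G : ℝ → E → ℝ} (hG : Continuous fun p : ℝ × E => G p.1 p.2)
    (hGm : Measurable fun p : ℝ × E => G p.1 p.2) {ρ : Measure E} [IsProbabilityMeasure ρ]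
    {ν : Measure ℝ} [IsProbabilityMeasure ν]
    (hν : ∀ c, ν {c} = 0) (hν' : ∀ l₀, 0 ≤ l₀ → ∀ δ, 0 < δ → 0 < ν {l | |l - l₀| < δ})
    (h : TendstoInDistribution (fun n ω => (L n ω, T n ω)) atTop
      (fun p : ℝ × E => (p.1, G p.1 p.2)) (fun _ => P) (ν.prod ρ)) :
    TendstoInDistributionGiven P T L G ρ := by
  refine ⟨⟨ν, inferInstance, h⟩, fun l₀ hl₀ f η hη => ?_⟩
  have hfG : ∀ l, Measurable fun q => f (G l q) := fun l =>
    f.continuous.measurable.comp (hGm.comp measurable_prodMk_left)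
  have hφ : Continuous fun l => ∫ q, f (G l q) ∂ρ := by
    refine continuous_of_dominated (bound := fun _ => ‖f‖)
      (fun l => (hfG l).aestronglyMeasurable)
      (fun l => ae_of_all _ fun q => f.norm_coe_le_norm _) (integrable_const _)
      (ae_of_all _ fun q => f.continuous.comp (hG.comp (Continuous.prodMk_left q)))
  set φ : ℝ → ℝ := fun l => ∫ q, f (G l q) ∂ρ with hφdef
  obtain ⟨δ₀, hδ₀, hδ₀'⟩ := Metric.continuous_iff.1 hφ l₀ (η / 2) (half_pos hη)
  refine ⟨δ₀, hδ₀, fun δ hδ hδδ₀ => ?_⟩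
  set A : Set ℝ := {l | |l - l₀| < δ} with hA
  have hAm : MeasurableSet A := measurableSet_lt (by fun_prop) (by fun_prop)
  have hAP : ∀ n, MeasurableSet {ω | |L n ω - l₀| < δ} := fun n => hL n hAm
  have key : ∀ g : ℝ →ᵇ ℝ, Tendsto (fun n => ∫ ω in {ω | |L n ω - l₀| < δ}, g (T n ω) ∂P) atTop
      (𝓝 (∫ l in A, ∫ q, g (G l q) ∂ρ ∂ν)) := by
    intro g
    have hgG : Measurable fun p : ℝ × E => g (G p.1 p.2) := g.continuous.measurable.comp hGm
    -- The window indicator is discontinuous only where the first coordinate is at distance exactly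
    -- `δ` from `l₀`.
    set F : ℝ × ℝ → ℝ := fun p => A.indicator 1 p.1 * g p.2 with hF
    have hFm : Measurable F := ((measurable_one.indicator hAm).comp measurable_fst).mul
      (g.continuous.measurable.comp measurable_snd)
    have hFb : ∀ p, |F p| ≤ ‖g‖ := fun p => by
      by_cases hp : p.1 ∈ A
      · simpa [hF, hp] using g.norm_coe_le_norm p.2
      · simp [hF, hp]
    have hU : IsOpen {p : ℝ × ℝ | |p.1 - l₀| ≠ δ} :=
      isOpen_ne_fun (by fun_prop) continuous_const
    have hFc : ContinuousOn F {p : ℝ × ℝ | |p.1 - l₀| ≠ δ} := by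
      intro p hp
      refine ContinuousAt.continuousWithinAt ?_
      refine ContinuousAt.mul ?_ (g.continuous.comp continuous_snd).continuousAt
      refine ContinuousAt.comp (f := Prod.fst) (g := A.indicator (1 : ℝ → ℝ)) ?_ continuousAt_fst
      rcases lt_or_gt_of_ne hp with hlt | hgt
      · have : A.indicator (1 : ℝ → ℝ) =ᶠ[𝓝 p.1] fun _ => 1 := by
          filter_upwards [(isOpen_lt (f := fun l : ℝ => |l - l₀|) (g := fun _ => δ) (by fun_prop)
            (by fun_prop)).mem_nhds hlt] with l hl
          exact Set.indicator_of_mem (s := A) hl 1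
        exact continuousAt_const.congr this.symm
      · have : A.indicator (1 : ℝ → ℝ) =ᶠ[𝓝 p.1] fun _ => 0 := by
          filter_upwards [(isOpen_lt (f := fun _ => δ) (g := fun l : ℝ => |l - l₀|) (by fun_prop)
            (by fun_prop)).mem_nhds hgt] with l hl
          exact Set.indicator_of_notMem (s := A) (by simpa [hA] using le_of_lt hl) 1
        exact continuousAt_const.congr this.symm
    have hd := tendstoInDistribution_of_continuousOn (Y := fun n ω => F (L n ω, T n ω))
      (Y' := fun p : ℝ × E => F (p.1, G p.1 p.2)) h
      (fun n => (hFm.comp ((hL n).prodMk (hT n))).aemeasurable)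
      (hFm.comp (measurable_fst.prodMk hGm)).aemeasurable F hU hFc ?_ (fun _ _ => rfl)
      (Eventually.of_forall fun _ _ _ => rfl)
    · have h2 := hd.tendsto_integral_of_abs_le (C := ‖g‖) (fun _ _ => hFb _) (fun _ => hFb _)
      have e1 : ∀ n, ∫ ω, F (L n ω, T n ω) ∂P
          = ∫ ω in {ω | |L n ω - l₀| < δ}, g (T n ω) ∂P := fun n => by
        rw [← integral_indicator (hAP n)]
        refine integral_congr_ae (ae_of_all _ fun ω => ?_)
        by_cases hω : |L n ω - l₀| < δ
        · simp [hF, hA, Set.indicator, hω]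
        · simp [hF, hA, Set.indicator, hω]
      have e2 : ∫ p, F (p.1, G p.1 p.2) ∂(ν.prod ρ) = ∫ l in A, ∫ q, g (G l q) ∂ρ ∂ν := by
        rw [integral_prod (fun p : ℝ × E => F (p.1, G p.1 p.2)) (Integrable.of_bound
          (hFm.comp (measurable_fst.prodMk hGm)).aestronglyMeasurable ‖g‖
          (ae_of_all _ fun p => hFb _)), ← integral_indicator hAm]
        refine integral_congr_ae (ae_of_all _ fun l => ?_)
        by_cases hl : l ∈ A
        · simp [hF, hl]
        · simp [hF, hl]
      simpa only [e1, e2] using h2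
    -- The boundary of the window consists of two points, which are not atoms of `ν`.
    · have hnull : ν {l | |l - l₀| = δ} = 0 := by
        refine measure_mono_null (t := {l₀ + δ} ∪ {l₀ - δ}) (fun l hl => ?_)
          (measure_union_null (hν _) (hν _))
        have hl' : |l - l₀| = δ := hl
        rcases abs_choice (l - l₀) with h' | h' <;> rw [h'] at hl'
        · left; simp only [Set.mem_singleton_iff]; linarith
        · right; simp only [Set.mem_singleton_iff]; linarith
      have hae : ∀ᵐ l ∂ν, |l - l₀| ≠ δ := by
        rw [ae_iff]; simpa using hnull
      exact Measure.quasiMeasurePreserving_fst.ae hae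
  -- The constant test function gives the probability of the window, the denominator of the
  -- conditional expectation.
  have hk1 := key (BoundedContinuousFunction.const ℝ 1)
  have hkf := key f
  simp only [BoundedContinuousFunction.const_apply, integral_const, smul_eq_mul, mul_one,
    probReal_univ, measureReal_restrict_apply MeasurableSet.univ, Set.univ_inter] at hk1
  have hνA : 0 < ν.real A := ENNReal.toReal_pos (hν' l₀ hl₀ δ hδ).ne' (measure_ne_top _ _)
  have hint : Integrable φ (ν.restrict A) := Integrable.of_bound
    hφ.aestronglyMeasurable ‖f‖ (ae_of_all _ fun l => by
      refine (norm_integral_le_of_norm_le_const (ae_of_all _ fun q => f.norm_coe_le_norm _)).trans ?_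
      simp)
  have hlim := hk1.inv₀ hνA.ne' |>.mul hkf
  -- An average of `φ` over the window differs from `φ l₀` by at most its oscillation there; the
  -- other η/2 is left for the limit in `n`.
  have hclose : |(ν.real A)⁻¹ * ∫ l in A, φ l ∂ν - φ l₀| ≤ η / 2 := by
    have : (ν.real A)⁻¹ * ∫ l in A, φ l ∂ν - φ l₀ = (ν.real A)⁻¹ * ∫ l in A, (φ l - φ l₀) ∂ν := by
      rw [integral_sub hint (integrable_const _), mul_sub]
      simp [hνA.ne']
    rw [this, abs_mul, abs_of_pos (inv_pos.2 hνA), inv_mul_le_iff₀ hνA, mul_comm]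
    rw [← Real.norm_eq_abs]
    refine norm_setIntegral_le_of_norm_le_const (measure_lt_top _ _) fun l hl => ?_
    exact (hδ₀' l (by simpa [Real.dist_eq] using lt_trans hl hδδ₀)).le
  have hev := (hlim.sub_const (φ l₀)).abs.eventually_lt_const (hclose.trans_lt (half_lt_self hη))
  filter_upwards [hev, hk1.eventually_const_lt hνA] with n hn hpos
  refine ⟨(ENNReal.toReal_pos_iff.1 hpos).1, ?_⟩
  rw [ProbabilityTheory.cond, integral_smul_measure, ENNReal.toReal_inv, smul_eq_mul]
  exact hn

/-! ### Infimum of a ratio of binary quadratic forms -/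

/-- If the quadratic polynomials `a - 2 b c + d c²` and `a' - 2 b' c + d' c²` (numerator and
positive denominator) are such that numerator minus `t` times denominator is a nonnegative perfect
square, then `t` is the infimum of their ratio. -/
theorem iInf_ratio_eq_of_det_eq_zero {a b d a' b' d' t : ℝ} (ha' : 0 < a')
    (hdet : 0 < a' * d' - b' ^ 2) (h₁ : 0 ≤ a - t * a') (h₂ : 0 ≤ d - t * d')
    (h : (a - t * a') * (d - t * d') = (b - t * b') ^ 2) :
    ⨅ c : ℝ, (a - 2 * c * b + c ^ 2 * d) / (a' - 2 * c * b' + c ^ 2 * d') = t := by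
  have hd' : 0 < d' := by
    by_contra hcon
    nlinarith [sq_nonneg b', mul_nonneg ha'.le (not_lt.1 hcon |> neg_nonneg.2)]
  have hden : ∀ c : ℝ, 0 < a' - 2 * c * b' + c ^ 2 * d' := fun c => by
    have : a' * (a' - 2 * c * b' + c ^ 2 * d') = (a' - c * b') ^ 2 + c ^ 2 * (a' * d' - b' ^ 2) := by
      ring
    by_contra hcon
    have h0 : a' * (a' - 2 * c * b' + c ^ 2 * d') ≤ 0 :=
      mul_nonpos_of_nonneg_of_nonpos ha'.le (not_lt.1 hcon)
    have h1 : c ^ 2 * (a' * d' - b' ^ 2) ≤ 0 := by nlinarith [sq_nonneg (a' - c * b')]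
    have h2 : c ^ 2 ≤ 0 := by
      by_contra h2
      exact absurd h1 (not_le.2 (mul_pos (not_le.1 h2) hdet))
    have h3 : c = 0 := (pow_eq_zero_iff two_ne_zero).1 (le_antisymm h2 (sq_nonneg c))
    rw [h3] at hcon
    norm_num at hcon
    linarith
  have hle : ∀ c : ℝ, t ≤ (a - 2 * c * b + c ^ 2 * d) / (a' - 2 * c * b' + c ^ 2 * d') := fun c => by
    rw [le_div_iff₀ (hden c)]
    have key : 0 ≤ (a - t * a') - 2 * c * (b - t * b') + c ^ 2 * (d - t * d') := by
      rcases h₁.eq_or_lt with h0 | h0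
      · rw [← h0, zero_mul] at h
        have hb : b - t * b' = 0 := (pow_eq_zero_iff two_ne_zero).1 h.symm
        rw [hb, ← h0]
        have := mul_nonneg (sq_nonneg c) h₂
        linarith
      · have : 0 ≤ (a - t * a') * ((a - t * a') - 2 * c * (b - t * b') + c ^ 2 * (d - t * d')) := by
          have e : (a - t * a') * ((a - t * a') - 2 * c * (b - t * b') + c ^ 2 * (d - t * d'))
            = ((a - t * a') - c * (b - t * b')) ^ 2 := by linear_combination c ^ 2 * h
          rw [e]; positivity
        exact nonneg_of_mul_nonneg_right this h0
    linarith
  refine le_antisymm ?_ (le_ciInf hle)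
  have hbdd : BddBelow (Set.range fun c : ℝ =>
      (a - 2 * c * b + c ^ 2 * d) / (a' - 2 * c * b' + c ^ 2 * d')) :=
    ⟨t, by rintro _ ⟨c, rfl⟩; exact hle c⟩
  rcases h₂.eq_or_lt with h0 | h0
  -- Degenerate case: numerator minus `t` times denominator is constant in `c`, and the infimum is
  -- approached as `c → ∞`.
  · rw [← h0, mul_zero] at h
    have hb : b - t * b' = 0 := (pow_eq_zero_iff two_ne_zero).1 h.symm
    have e : ∀ c : ℝ, (a - 2 * c * b + c ^ 2 * d) / (a' - 2 * c * b' + c ^ 2 * d')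
        = t + (a - t * a') / (a' - 2 * c * b' + c ^ 2 * d') := fun c => by
      have := (hden c).ne'
      field_simp
      linear_combination (-2 * c) * hb - c ^ 2 * h0
    have hlim : Tendsto (fun c : ℝ => t + (a - t * a') / (a' - 2 * c * b' + c ^ 2 * d')) atTop
        (𝓝 (t + 0)) := by
      refine tendsto_const_nhds.add (Tendsto.div_atTop tendsto_const_nhds ?_)
      have : Tendsto (fun c : ℝ => a' + c * (c * d' - 2 * b')) atTop atTop :=
        tendsto_atTop_add_const_left _ _ (tendsto_id.atTop_mul_atTop₀
          (tendsto_atTop_add_const_right _ _ (tendsto_id.atTop_mul_const hd')))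
      refine this.congr fun c => by ring
    rw [add_zero] at hlim
    refine ge_of_tendsto hlim (Eventually.of_forall fun c => ?_)
    rw [← e c]
    exact ciInf_le hbdd c
  -- Otherwise the perfect square has a zero, and the infimum is attained there.
  · refine (ciInf_le hbdd ((b - t * b') / (d - t * d'))).trans ?_
    rw [div_le_iff₀ (hden _)]
    have h0' := h0.ne'
    set c := (b - t * b') / (d - t * d') with hc
    have hcd : c * (d - t * d') = b - t * b' := by rw [hc]; field_simp
    have hz : (a - t * a') - c * (b - t * b') = 0 := by
      have : (d - t * d') * ((a - t * a') - c * (b - t * b')) = 0 := by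
        linear_combination h - (b - t * b') * hcd
      exact (mul_eq_zero.1 this).resolve_left h0'
    nlinarith [hz, hcd]

/-- The smallest generalized eigenvalue of a pair of binary quadratic forms is the infimum of their
ratio, in coordinates where the denominator is diagonal. -/
theorem iInf_ratio_eq {a b d a' b' d' : ℝ} (ha' : 0 < a') (hm : 0 < d' - b' ^ 2 / a') :
    ⨅ c : ℝ, (a - 2 * c * b + c ^ 2 * d) / (a' - 2 * c * b' + c ^ 2 * d') =
      (1 / 2) * (a / a' + (d - 2 * (b' / a') * b + (b' / a') ^ 2 * a) / (d' - b' ^ 2 / a')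
        - √((a / a' - (d - 2 * (b' / a') * b + (b' / a') ^ 2 * a) / (d' - b' ^ 2 / a')) ^ 2
          + 4 * ((b - b' / a' * a) ^ 2 / (a' * (d' - b' ^ 2 / a'))))) := by
  set r := b' / a' with hr
  set m := d' - b' ^ 2 / a' with hmdef
  set q := a / a' with hq
  set l := (d - 2 * r * b + r ^ 2 * a) / m with hl
  set s := (b - r * a) ^ 2 / (a' * m) with hs
  have ha'0 := ha'.ne'
  have hm0 := hm.ne'
  have hb' : b' = r * a' := by rw [hr]; field_simp
  have hd' : d' = m + r ^ 2 * a' := by rw [hmdef, hb']; field_simp; ring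
  have ha : a = q * a' := by rw [hq]; field_simp
  have hd : d = l * m + 2 * r * b - r ^ 2 * a := by rw [hl]; field_simp; ring
  have hsb : (b - r * a) ^ 2 = s * (a' * m) := by rw [hs]; field_simp
  have hs0 : 0 ≤ s := by rw [hs]; positivity
  have hD : 0 ≤ (q - l) ^ 2 + 4 * s := by positivity
  set w := √((q - l) ^ 2 + 4 * s) with hw
  have hw2 : w ^ 2 = (q - l) ^ 2 + 4 * s := Real.sq_sqrt hD
  have hwabs : |q - l| ≤ w := Real.le_sqrt_of_sq_le (by rw [sq_abs]; linarith)
  have hw1 := (abs_le.1 hwabs)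
  -- The smaller root of `(q - t) * (l - t) = s`, the characteristic equation once `r` has been used
  -- to diagonalize the denominator.
  set t := (1 / 2) * (q + l - w) with ht
  have hqt : 0 ≤ q - t := by rw [ht]; linarith
  have hlt : 0 ≤ l - t := by rw [ht]; linarith
  have hprod : (q - t) * (l - t) = s := by rw [ht]; linear_combination (1 / 4) * hw2
  have hα : a - t * a' = a' * (q - t) := by rw [ha]; ring
  have hβ : b - t * b' = (b - r * a) + r * (a - t * a') := by rw [hb']; ring
  have hγ : d - t * d' = m * (l - t) + 2 * r * (b - r * a) + r ^ 2 * (a - t * a') := by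
    rw [hd', hd]; ring
  have hα0 : 0 ≤ a - t * a' := by rw [hα]; positivity
  have hdetz : (a - t * a') * (d - t * d') = (b - t * b') ^ 2 := by
    rw [hγ, hβ]
    linear_combination (m * (l - t)) * hα + (a' * m) * hprod - hsb
  refine iInf_ratio_eq_of_det_eq_zero ha' ?_ hα0 ?_ hdetz
  · have : a' * d' - b' ^ 2 = a' * m := by rw [hd', hb']; ring
    rw [this]; positivity
  · rcases hα0.eq_or_lt with h0 | h0
    · have hqt0 : q - t = 0 := by
        rw [hα] at h0
        exact (mul_eq_zero.1 h0.symm).resolve_left ha'0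
      have hs00 : s = 0 := by rw [← hprod, hqt0, zero_mul]
      have hb0 : b - r * a = 0 := by
        rw [hs00, zero_mul] at hsb
        exact (pow_eq_zero_iff two_ne_zero).1 hsb
      rw [hγ, hb0, ← h0]
      have := mul_nonneg hm.le hlt
      linarith
    · exact nonneg_of_mul_nonneg_right (by rw [hdetz]; positivity) h0

/-! ### Projections and their quadratic forms -/

section Projection

variable {n k : ℕ} (Z : Matrix (Fin n) (Fin k) ℝ)

theorem projZ_transpose : (projZ Z)ᵀ = projZ Z := by
  simp [projZ, Matrix.transpose_mul, Matrix.transpose_nonsing_inv, Matrix.mul_assoc]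

theorem annZ_transpose : (annZ Z)ᵀ = annZ Z := by
  simp [annZ, projZ_transpose]

/-- No rank condition is needed: for singular `ZᵀZ` the inverse is zero by convention, and so is
`projZ Z`. -/
theorem projZ_mul_self : projZ Z * projZ Z = projZ Z := by
  by_cases h : IsUnit (Zᵀ * Z).det
  · have : projZ Z * projZ Z = Z * ((Zᵀ * Z)⁻¹ * (Zᵀ * Z)) * (Zᵀ * Z)⁻¹ * Zᵀ := by
      simp only [projZ, Matrix.mul_assoc]
    rw [this, Matrix.nonsing_inv_mul _ h, Matrix.mul_one, projZ]
  · simp [projZ, Matrix.nonsing_inv_apply_not_isUnit _ h]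

theorem annZ_mul_self : annZ Z * annZ Z = annZ Z := by
  simp [annZ, Matrix.mul_sub, Matrix.sub_mul, projZ_mul_self]

end Projection

section QuadraticForm

variable {n : ℕ} {M : Matrix (Fin n) (Fin n) ℝ}

theorem dotProduct_mulVec_comm_of_transpose_eq (hM : Mᵀ = M) (u v : Fin n → ℝ) :
    u ⬝ᵥ M *ᵥ v = v ⬝ᵥ M *ᵥ u := by
  rw [Matrix.dotProduct_mulVec, ← Matrix.mulVec_transpose, hM, dotProduct_comm]

theorem sub_smul_dotProduct_mulVec (hM : Mᵀ = M) (u v : Fin n → ℝ) (c : ℝ) :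
    (u - c • v) ⬝ᵥ M *ᵥ (u - c • v) =
      u ⬝ᵥ M *ᵥ u - 2 * c * (u ⬝ᵥ M *ᵥ v) + c ^ 2 * (v ⬝ᵥ M *ᵥ v) := by
  simp only [Matrix.mulVec_sub, Matrix.mulVec_smul, sub_dotProduct, dotProduct_sub,
    smul_dotProduct, dotProduct_smul, smul_eq_mul,
    dotProduct_mulVec_comm_of_transpose_eq hM v u]
  ring

theorem dotProduct_mulVec_nonneg_of_idempotent (hM : Mᵀ = M) (hM' : M * M = M) (u : Fin n → ℝ) :
    0 ≤ u ⬝ᵥ M *ᵥ u := by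
  rw [← hM', ← Matrix.mulVec_mulVec, Matrix.dotProduct_mulVec, ← Matrix.mulVec_transpose, hM]
  simpa using dotProduct_star_self_nonneg (M *ᵥ u)

end QuadraticForm

/-! ### The statistics in terms of quadratic form entries -/

section Statistics

variable {n k : ℕ} (Z : Matrix (Fin n) (Fin k) ℝ) (X e : Fin n → ℝ) (β : ℝ)

theorem arRatio_eq (b : ℝ) :
    arRatio Z X (β • X + e) b =
      (e ⬝ᵥ projZ Z *ᵥ e - 2 * (b - β) * (e ⬝ᵥ projZ Z *ᵥ X)
          + (b - β) ^ 2 * (X ⬝ᵥ projZ Z *ᵥ X)) /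
        (e ⬝ᵥ annZ Z *ᵥ e - 2 * (b - β) * (e ⬝ᵥ annZ Z *ᵥ X)
          + (b - β) ^ 2 * (X ⬝ᵥ annZ Z *ᵥ X)) := by
  have : β • X + e - b • X = e - (b - β) • X := by rw [sub_smul]; abel
  rw [arRatio, this, sub_smul_dotProduct_mulVec (projZ_transpose Z),
    sub_smul_dotProduct_mulVec (annZ_transpose Z)]

/-- Translating the parameter by β removes it from the infimum, since the residual at `b` is `e - (b
- β) • X`. -/
theorem iInf_arRatio_eq :
    ⨅ b, arRatio Z X (β • X + e) b = ⨅ c : ℝ,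
      (e ⬝ᵥ projZ Z *ᵥ e - 2 * c * (e ⬝ᵥ projZ Z *ᵥ X) + c ^ 2 * (X ⬝ᵥ projZ Z *ᵥ X)) /
        (e ⬝ᵥ annZ Z *ᵥ e - 2 * c * (e ⬝ᵥ annZ Z *ᵥ X) + c ^ 2 * (X ⬝ᵥ annZ Z *ᵥ X)) := by
  simp_rw [arRatio_eq]
  exact (Equiv.subRight β).iInf_comp (g := fun c : ℝ =>
    (e ⬝ᵥ projZ Z *ᵥ e - 2 * c * (e ⬝ᵥ projZ Z *ᵥ X) + c ^ 2 * (X ⬝ᵥ projZ Z *ᵥ X)) /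
        (e ⬝ᵥ annZ Z *ᵥ e - 2 * c * (e ⬝ᵥ annZ Z *ᵥ X) + c ^ 2 * (X ⬝ᵥ annZ Z *ᵥ X)))

/-- The likelihood-ratio statistic as a function of the entries of the two quadratic forms. -/
theorem lrStat_eq {a b d a' b' d' : ℝ}
    (ha : e ⬝ᵥ projZ Z *ᵥ e = a) (hb : e ⬝ᵥ projZ Z *ᵥ X = b) (hd : X ⬝ᵥ projZ Z *ᵥ X = d)
    (ha' : e ⬝ᵥ annZ Z *ᵥ e = a') (hb' : e ⬝ᵥ annZ Z *ᵥ X = b') (hd' : X ⬝ᵥ annZ Z *ᵥ X = d')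
    (h1 : 0 < a') (h2 : 0 < d' - b' ^ 2 / a') :
    lrStat Z X (β • X + e) β = ((n : ℝ) - k) * ((1 / 2) *
      (a / a' - (d - 2 * (b' / a') * b + (b' / a') ^ 2 * a) / (d' - b' ^ 2 / a')
        + √((a / a' - (d - 2 * (b' / a') * b + (b' / a') ^ 2 * a) / (d' - b' ^ 2 / a')) ^ 2
          + 4 * ((b - b' / a' * a) ^ 2 / (a' * (d' - b' ^ 2 / a')))))) := by
  rw [lrStat, iInf_arRatio_eq, arRatio_eq, ha, hb, hd, ha', hb', hd', iInf_ratio_eq h1 h2]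
  simp only [sub_self, mul_zero, zero_mul, ne_eq, OfNat.ofNat_ne_zero, not_false_eq_true, zero_pow,
    sub_zero, add_zero]
  ring

theorem lambdaStat_eq {a b d a' b' d' : ℝ}
    (ha : e ⬝ᵥ projZ Z *ᵥ e = a) (hb : e ⬝ᵥ projZ Z *ᵥ X = b) (hd : X ⬝ᵥ projZ Z *ᵥ X = d)
    (ha' : e ⬝ᵥ annZ Z *ᵥ e = a') (hb' : e ⬝ᵥ annZ Z *ᵥ X = b') (hd' : X ⬝ᵥ annZ Z *ᵥ X = d')
    (h1 : 0 < a') :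
    lambdaStat Z X (β • X + e) β = ((n : ℝ) - k) *
      ((d - 2 * (b' / a') * b + (b' / a') ^ 2 * a) / (d' - b' ^ 2 / a')) := by
  have h1' := h1.ne'
  have : β • X + e - β • X = e := by abel
  rw [lambdaStat, tildeX, this, ha', hb', sub_smul_dotProduct_mulVec (projZ_transpose Z),
    sub_smul_dotProduct_mulVec (annZ_transpose Z),
    dotProduct_mulVec_comm_of_transpose_eq (projZ_transpose Z) X e,
    dotProduct_mulVec_comm_of_transpose_eq (annZ_transpose Z) X e, ha, hb, hd, ha', hb', hd']
  have e1 : d' - 2 * (b' / a') * b' + (b' / a') ^ 2 * a' = d' - b' ^ 2 / a' := by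
    field_simp; ring
  rw [e1, mul_assoc, div_eq_inv_mul (d - _ + _)]

end Statistics

/-! ### Inverse square roots of Gram matrices -/

section InvSqrt

variable {n k : ℕ}

theorem invSqrt_transpose (A : Matrix (Fin k) (Fin k) ℝ) : (invSqrt A)ᵀ = invSqrt A := by
  rw [← Matrix.conjTranspose_eq_transpose_of_trivial]
  exact (cfc_predicate (R := ℝ) (p := IsSelfAdjoint) (fun x : ℝ => (√x)⁻¹) A)

theorem Matrix.PosDef.pos_of_mem_spectrum {A : Matrix (Fin k) (Fin k) ℝ} (hA : A.PosDef)
    {x : ℝ} (hx : x ∈ spectrum ℝ A) : 0 < x := by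
  rw [hA.isHermitian.spectrum_real_eq_range_eigenvalues] at hx
  obtain ⟨i, rfl⟩ := hx
  exact hA.eigenvalues_pos i

theorem Matrix.PosDef.continuousOn_inv_sqrt {A : Matrix (Fin k) (Fin k) ℝ} (hA : A.PosDef) :
    ContinuousOn (fun x : ℝ => (√x)⁻¹) (spectrum ℝ A) :=
  Real.continuous_sqrt.continuousOn.inv₀ fun _ hx =>
    (Real.sqrt_pos.2 (hA.pos_of_mem_spectrum hx)).ne'

theorem invSqrt_mul_self {A : Matrix (Fin k) (Fin k) ℝ} (hA : A.PosDef) :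
    invSqrt A * A = cfc Real.sqrt A := by
  have hsa : IsSelfAdjoint A := hA.isHermitian
  calc invSqrt A * A = cfc (fun x : ℝ => (√x)⁻¹) A * cfc (fun x : ℝ => x) A := by
        rw [cfc_id' ℝ A, invSqrt]
    _ = cfc (fun x : ℝ => (√x)⁻¹ * x) A :=
        (cfc_mul _ _ A hA.continuousOn_inv_sqrt (by fun_prop)).symm
    _ = cfc Real.sqrt A := cfc_congr fun x hx => by
        have := hA.pos_of_mem_spectrum hx
        have h2 := (Real.sqrt_pos.2 this).ne'
        change (√x)⁻¹ * x = √x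
        rw [inv_mul_eq_iff_eq_mul₀ h2, Real.mul_self_sqrt this.le]

theorem invSqrt_mul_invSqrt {A : Matrix (Fin k) (Fin k) ℝ} (hA : A.PosDef) :
    invSqrt A * invSqrt A = A⁻¹ := by
  have hsa : IsSelfAdjoint A := hA.isHermitian
  refine (Matrix.inv_eq_left_inv ?_).symm
  rw [mul_assoc, invSqrt_mul_self hA, invSqrt,
    ← cfc_mul _ _ A hA.continuousOn_inv_sqrt (by fun_prop)]
  rw [← cfc_one ℝ A]
  refine cfc_congr fun x hx => ?_
  exact inv_mul_cancel₀ (Real.sqrt_pos.2 (hA.pos_of_mem_spectrum hx)).ne'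

theorem cfc_sqrt_smul {A : Matrix (Fin k) (Fin k) ℝ} (hA : A.PosSemidef) {c : ℝ} (hc : 0 ≤ c) :
    cfc Real.sqrt (c • A) = √c • cfc Real.sqrt A := by
  have hsa : IsSelfAdjoint A := hA.isHermitian
  rw [← cfc_comp_smul c Real.sqrt A (by fun_prop), ← cfc_smul (√c) Real.sqrt A (by fun_prop)]
  refine cfc_congr fun x hx => ?_
  simp [Real.sqrt_mul hc]

theorem posDef_transpose_mul_self {Z : Matrix (Fin n) (Fin k) ℝ} (hZ : (Zᵀ * Z).det ≠ 0) :
    (Zᵀ * Z).PosDef := by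
  have := Matrix.posSemidef_conjTranspose_mul_self Z
  rw [Matrix.conjTranspose_eq_transpose_of_trivial] at this
  exact this.posDef_iff_isUnit.2 ((Matrix.isUnit_iff_isUnit_det _).2 hZ.isUnit)

/-- This factorization turns the projected form into ordinary dot products of normalised vectors, in
particular of the columns of Ψ. -/
theorem projZ_eq_mul_transpose {Z : Matrix (Fin n) (Fin k) ℝ} (hZ : (Zᵀ * Z).det ≠ 0) :
    projZ Z = (invSqrt (Zᵀ * Z) * Zᵀ)ᵀ * (invSqrt (Zᵀ * Z) * Zᵀ) := by
  rw [Matrix.transpose_mul, Matrix.transpose_transpose, invSqrt_transpose, Matrix.mul_assoc,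
    ← Matrix.mul_assoc (invSqrt _) (invSqrt _),
    invSqrt_mul_invSqrt (posDef_transpose_mul_self hZ), projZ, Matrix.mul_assoc]

theorem dotProduct_projZ_mulVec {Z : Matrix (Fin n) (Fin k) ℝ} (hZ : (Zᵀ * Z).det ≠ 0)
    (u v : Fin n → ℝ) :
    u ⬝ᵥ projZ Z *ᵥ v =
      ((invSqrt (Zᵀ * Z) * Zᵀ) *ᵥ u) ⬝ᵥ ((invSqrt (Zᵀ * Z) * Zᵀ) *ᵥ v) := by
  rw [projZ_eq_mul_transpose hZ, ← Matrix.mulVec_mulVec, Matrix.dotProduct_mulVec,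
    ← Matrix.mulVec_transpose, Matrix.transpose_transpose]

theorem annZ_mul {Z : Matrix (Fin n) (Fin k) ℝ} (hZ : (Zᵀ * Z).det ≠ 0) : annZ Z * Z = 0 := by
  rw [annZ, projZ, Matrix.sub_mul, Matrix.one_mul, Matrix.mul_assoc, Matrix.mul_assoc,
    Matrix.nonsing_inv_mul _ hZ.isUnit, Matrix.mul_one, sub_self]

theorem dotProduct_annZ_mulVec {Z : Matrix (Fin n) (Fin k) ℝ} (hZ : (Zᵀ * Z).det ≠ 0)
    (u v : Fin n → ℝ) (p : Fin k → ℝ) :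
    u ⬝ᵥ annZ Z *ᵥ (Z *ᵥ p + v) = u ⬝ᵥ v -
      ((invSqrt (Zᵀ * Z) * Zᵀ) *ᵥ u) ⬝ᵥ ((invSqrt (Zᵀ * Z) * Zᵀ) *ᵥ v) := by
  rw [Matrix.mulVec_add, Matrix.mulVec_mulVec, annZ_mul hZ, Matrix.zero_mulVec, zero_add,
    ← dotProduct_projZ_mulVec hZ, annZ, Matrix.sub_mulVec, Matrix.one_mulVec, dotProduct_sub]

theorem psiMatrix_col_zero (Z : Matrix (Fin n) (Fin k) ℝ) (ε V : Fin n → ℝ) :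
    (fun i => psiMatrix Z ε V i 0) = (invSqrt (Zᵀ * Z) * Zᵀ) *ᵥ ε := by
  ext i
  rw [psiMatrix, Matrix.mul_apply]
  simp [Matrix.mulVec, dotProduct, errorMatrix]

theorem psiMatrix_col_one (Z : Matrix (Fin n) (Fin k) ℝ) (ε V : Fin n → ℝ) :
    (fun i => psiMatrix Z ε V i 1) = (invSqrt (Zᵀ * Z) * Zᵀ) *ᵥ V := by
  ext i
  rw [psiMatrix, Matrix.mul_apply]
  simp [Matrix.mulVec, dotProduct, errorMatrix]

/-- The weak-instrument scaling enters here: (ZᵀZ)^(1/2) p = (ZᵀZ/n)^(1/2) (√n p), where √n p stays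
fixed and ZᵀZ/n converges. -/
theorem invSqrt_mul_transpose_mulVec {Z : Matrix (Fin n) (Fin k) ℝ} (hZ : (Zᵀ * Z).det ≠ 0)
    (hn : 0 < n) (p : Fin k → ℝ) (v : Fin n → ℝ) :
    (invSqrt (Zᵀ * Z) * Zᵀ) *ᵥ (Z *ᵥ p + v) =
      cfc Real.sqrt ((n : ℝ)⁻¹ • (Zᵀ * Z)) *ᵥ (√n • p) + (invSqrt (Zᵀ * Z) * Zᵀ) *ᵥ v := by
  have hn' : (0 : ℝ) < √n := Real.sqrt_pos.2 (Nat.cast_pos.2 hn)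
  have hpd := posDef_transpose_mul_self hZ
  rw [Matrix.mulVec_add, Matrix.mulVec_mulVec, Matrix.mul_assoc, invSqrt_mul_self hpd,
    cfc_sqrt_smul hpd.posSemidef (by positivity), Matrix.smul_mulVec, Matrix.mulVec_smul,
    smul_smul, Real.sqrt_inv, inv_mul_cancel₀ hn'.ne', one_smul]

theorem transpose_errorMatrix_mul (ε V : Fin n → ℝ) :
    (errorMatrix ε V)ᵀ * errorMatrix ε V = !![ε ⬝ᵥ ε, ε ⬝ᵥ V; V ⬝ᵥ ε, V ⬝ᵥ V] := by
  ext i j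
  fin_cases i <;> fin_cases j <;> simp [Matrix.mul_apply, errorMatrix, dotProduct]

end InvSqrt

/-! ### Continuity of the matrix square root -/

section CfcContinuity

open scoped Matrix.Norms.L2Operator

/-- The square root of the symmetric part of a matrix depends continuously on the matrix. -/
theorem continuous_cfc_sqrt_symm {k : ℕ} :
    Continuous fun S : Matrix (Fin k) (Fin k) ℝ => cfc Real.sqrt ((1 / 2 : ℝ) • (S + Sᵀ)) := by
  -- Symmetrizing makes the argument self-adjoint for every `S`, and `Real.sqrt` is continuous on
  -- all of ℝ, so neither symmetry nor positivity has to be assumed.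
  refine Continuous.cfc_of_mem_nhdsSet (A := Matrix (Fin k) (Fin k) ℝ)
    (s := Set.univ) Real.sqrt Filter.univ_mem ?_ ?_
    Real.continuous_sqrt.continuousOn
  · have h : Continuous fun S : Matrix (Fin k) (Fin k) ℝ => S + Sᵀ :=
      continuous_id.add continuous_id.matrix_transpose
    exact h.const_smul (1 / 2 : ℝ)
  · intro S
    change _ = _
    rw [Matrix.star_eq_conjTranspose, Matrix.conjTranspose_eq_transpose_of_trivial]
    simp [add_comm]

end CfcContinuity

/-! ### Measurability of the statistics -/

section Measurability

variable {Ω : Type*} [MeasurableSpace Ω]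

theorem measurable_matrix_det {k : ℕ} {A : Ω → Matrix (Fin k) (Fin k) ℝ}
    (hA : ∀ i j, Measurable fun ω => A ω i j) : Measurable fun ω => (A ω).det := by
  simp_rw [Matrix.det_apply]
  exact Finset.measurable_sum _ fun σ _ =>
    (Finset.measurable_prod _ fun i _ => hA _ _).const_smul _

theorem measurable_matrix_mul {l m n : ℕ} {A : Ω → Matrix (Fin l) (Fin m) ℝ}
    {B : Ω → Matrix (Fin m) (Fin n) ℝ} (hA : ∀ i j, Measurable fun ω => A ω i j)
    (hB : ∀ i j, Measurable fun ω => B ω i j) (i : Fin l) (j : Fin n) :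
    Measurable fun ω => (A ω * B ω) i j := by
  simp_rw [Matrix.mul_apply]
  exact Finset.measurable_sum _ fun _ _ => (hA _ _).mul (hB _ _)

/-- By Cramer's rule the entries are ratios of determinants; singular matrices cause no trouble
because inversion in ℝ is total and measurable. -/
theorem measurable_matrix_inv {k : ℕ} {A : Ω → Matrix (Fin k) (Fin k) ℝ}
    (hA : ∀ i j, Measurable fun ω => A ω i j) (i j : Fin k) :
    Measurable fun ω => (A ω)⁻¹ i j := by
  simp_rw [Matrix.inv_def, Matrix.smul_apply, Ring.inverse_eq_inv, smul_eq_mul,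
    Matrix.adjugate_apply]
  refine (measurable_matrix_det hA).inv.mul (measurable_matrix_det fun i' j' => ?_)
  by_cases h : i' = j
  · subst h; simp
  · simpa [Matrix.updateRow_ne h] using hA i' j'

theorem measurable_dotProduct_mulVec {n : ℕ} {A : Ω → Matrix (Fin n) (Fin n) ℝ}
    {u v : Ω → Fin n → ℝ} (hA : ∀ i j, Measurable fun ω => A ω i j)
    (hu : ∀ i, Measurable fun ω => u ω i) (hv : ∀ i, Measurable fun ω => v ω i) :
    Measurable fun ω => u ω ⬝ᵥ A ω *ᵥ v ω := by
  change Measurable fun ω => ∑ i, u ω i * ∑ j, A ω i j * v ω j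
  exact Finset.measurable_sum _ fun i _ =>
    (hu i).mul (Finset.measurable_sum _ fun j _ => (hA i j).mul (hv j))

variable {n k : ℕ} {Z : Ω → Matrix (Fin n) (Fin k) ℝ} {X y : Ω → Fin n → ℝ}

theorem measurable_projZ (hZ : ∀ i j, Measurable fun ω => Z ω i j) (i j : Fin n) :
    Measurable fun ω => projZ (Z ω) i j :=
  have hZt : ∀ i j, Measurable fun ω => (Z ω)ᵀ i j := fun i j => hZ j i
  measurable_matrix_mul (measurable_matrix_mul hZ
    (measurable_matrix_inv (measurable_matrix_mul hZt hZ))) hZt i j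

theorem measurable_annZ (hZ : ∀ i j, Measurable fun ω => Z ω i j) (i j : Fin n) :
    Measurable fun ω => annZ (Z ω) i j :=
  measurable_const.sub (measurable_projZ hZ i j)

theorem measurable_tildeX (hZ : ∀ i j, Measurable fun ω => Z ω i j)
    (hX : ∀ i, Measurable fun ω => X ω i) (hy : ∀ i, Measurable fun ω => y ω i) (β : ℝ)
    (i : Fin n) : Measurable fun ω => tildeX (Z ω) (X ω) (y ω) β i := by
  have he : ∀ i, Measurable fun ω => (y ω - β • X ω) i := fun i =>
    (hy i).sub ((hX i).const_mul β)
  exact (hX i).sub (((measurable_dotProduct_mulVec (measurable_annZ hZ) he hX).div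
    (measurable_dotProduct_mulVec (measurable_annZ hZ) he he)).mul (he i))

theorem measurable_lambdaStat (hZ : ∀ i j, Measurable fun ω => Z ω i j)
    (hX : ∀ i, Measurable fun ω => X ω i) (hy : ∀ i, Measurable fun ω => y ω i) (β : ℝ) :
    Measurable fun ω => lambdaStat (Z ω) (X ω) (y ω) β := by
  have h := measurable_tildeX hZ hX hy β
  exact (measurable_const.mul (measurable_dotProduct_mulVec (measurable_annZ hZ) h h).inv).mul
    (measurable_dotProduct_mulVec (measurable_projZ hZ) h h)

theorem measurable_arRatio (hZ : ∀ i j, Measurable fun ω => Z ω i j)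
    (hX : ∀ i, Measurable fun ω => X ω i) (hy : ∀ i, Measurable fun ω => y ω i) (b : ℝ) :
    Measurable fun ω => arRatio (Z ω) (X ω) (y ω) b := by
  have he : ∀ i, Measurable fun ω => (y ω - b • X ω) i := fun i =>
    (hy i).sub ((hX i).const_mul b)
  exact (measurable_dotProduct_mulVec (measurable_projZ hZ) he he).div
    (measurable_dotProduct_mulVec (measurable_annZ hZ) he he)

/-- The infimum in the likelihood-ratio statistic is attained at a point where the denominator
vanishes, or may be taken over rational parameters. -/
theorem iInf_arRatio_eq_ite (Z : Matrix (Fin n) (Fin k) ℝ) (X y : Fin n → ℝ) :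
    ⨅ b, arRatio Z X y b =
      if (y ⬝ᵥ annZ Z *ᵥ y) * (X ⬝ᵥ annZ Z *ᵥ X) = (y ⬝ᵥ annZ Z *ᵥ X) ^ 2 ∧ X ⬝ᵥ annZ Z *ᵥ X ≠ 0
      then 0 else ⨅ q : ℚ, arRatio Z X y q := by
  have hP := dotProduct_mulVec_nonneg_of_idempotent (projZ_transpose Z) (projZ_mul_self Z)
  have hM := dotProduct_mulVec_nonneg_of_idempotent (annZ_transpose Z) (annZ_mul_self Z)
  have hnonneg : ∀ b, 0 ≤ arRatio Z X y b := fun b => div_nonneg (hP _) (hM _)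
  have hbdd : BddBelow (Set.range fun b => arRatio Z X y b) :=
    ⟨0, by rintro _ ⟨b, rfl⟩; exact hnonneg b⟩
  have hden : ∀ b : ℝ, (y - b • X) ⬝ᵥ annZ Z *ᵥ (y - b • X) =
      y ⬝ᵥ annZ Z *ᵥ y - 2 * b * (y ⬝ᵥ annZ Z *ᵥ X) + b ^ 2 * (X ⬝ᵥ annZ Z *ᵥ X) := fun b =>
    sub_smul_dotProduct_mulVec (annZ_transpose Z) y X b
  have hnum : ∀ b : ℝ, (y - b • X) ⬝ᵥ projZ Z *ᵥ (y - b • X) =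
      y ⬝ᵥ projZ Z *ᵥ y - 2 * b * (y ⬝ᵥ projZ Z *ᵥ X) + b ^ 2 * (X ⬝ᵥ projZ Z *ᵥ X) := fun b =>
    sub_smul_dotProduct_mulVec (projZ_transpose Z) y X b
  have hdn : ∀ b : ℝ, 0 ≤
      y ⬝ᵥ annZ Z *ᵥ y - 2 * b * (y ⬝ᵥ annZ Z *ᵥ X) + b ^ 2 * (X ⬝ᵥ annZ Z *ᵥ X) := fun b => by
    rw [← hden]; exact hM _
  have hd0 := hM X
  have hrat : ∀ b, arRatio Z X y b = _ / _ := fun b => by rw [arRatio, hden, hnum]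
  set a := y ⬝ᵥ annZ Z *ᵥ y
  set c := y ⬝ᵥ annZ Z *ᵥ X
  set d := X ⬝ᵥ annZ Z *ᵥ X
  have hcont : (∀ b : ℝ, a - 2 * b * c + b ^ 2 * d ≠ 0) →
      ⨅ b, arRatio Z X y b = ⨅ q : ℚ, arRatio Z X y q := fun hne => by
    have hc : Continuous fun b => arRatio Z X y b := by
      simp_rw [hrat]
      exact Continuous.div (by fun_prop) (by fun_prop) hne
    refine le_antisymm (le_ciInf fun q => ciInf_le hbdd _) (le_ciInf fun b => ?_)
    refine isClosed_property (Rat.denseRange_cast (𝕜 := ℝ)) (p := fun b =>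
      ⨅ q : ℚ, arRatio Z X y q ≤ arRatio Z X y b) (isClosed_le continuous_const hc)
      (fun q => ciInf_le ?_ q) b
    exact ⟨0, by rintro _ ⟨b, rfl⟩; exact hnonneg b⟩
  split_ifs with h
  -- The denominator vanishes at `c / d`, where division by zero gives the ratio 0, the least
  -- possible value.
  · refine le_antisymm ((ciInf_le hbdd (c / d)).trans_eq ?_) (le_ciInf hnonneg)
    rw [hrat]
    have hd := h.2
    have : a - 2 * (c / d) * c + (c / d) ^ 2 * d = 0 := by
      field_simp
      linear_combination h.1
    rw [this, div_zero]
  · rcases eq_or_ne d 0 with hd | hd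
    · have hc0 : c = 0 := by
        by_contra hc0
        -- With `d = 0` the denominator is affine in the parameter; at this point it would equal -1.
        have h1 := hdn ((a + 1) / (2 * c))
        have h2 : a - 2 * ((a + 1) / (2 * c)) * c + ((a + 1) / (2 * c)) ^ 2 * d = -1 := by
          rw [hd]; field_simp; ring
        rw [h2] at h1
        linarith
      rcases eq_or_ne a 0 with ha | ha
      · simp [hrat, hd, hc0, ha]
      · exact hcont fun b => by simpa [hd, hc0] using ha
    · refine hcont fun b hb => ?_
      have hdet : 0 ≤ a * d - c ^ 2 := by
        have h1 := hdn (c / d)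
        have h2 : a - 2 * (c / d) * c + (c / d) ^ 2 * d = (a * d - c ^ 2) / d := by
          field_simp; ring
        rw [h2] at h1
        by_contra hneg
        exact absurd h1 (not_le.2 (div_neg_of_neg_of_pos (not_le.1 hneg) (hd0.lt_of_ne' hd)))
      have h3 : (b * d - c) ^ 2 + (a * d - c ^ 2) = 0 := by linear_combination d * hb
      exact h ⟨by nlinarith [sq_nonneg (b * d - c)], hd⟩

theorem measurable_lrStat (hZ : ∀ i j, Measurable fun ω => Z ω i j)
    (hX : ∀ i, Measurable fun ω => X ω i) (hy : ∀ i, Measurable fun ω => y ω i) (β : ℝ) :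
    Measurable fun ω => lrStat (Z ω) (X ω) (y ω) β := by
  have hA := measurable_annZ hZ
  simp_rw [lrStat, iInf_arRatio_eq_ite]
  refine ((measurable_arRatio hZ hX hy β).const_mul _).sub (Measurable.const_mul ?_ _)
  refine Measurable.ite ?_ measurable_const
    (Measurable.iInf fun q => measurable_arRatio hZ hX hy (q : ℝ))
  have h1 := measurable_dotProduct_mulVec hA hX hX
  exact (measurableSet_eq_fun ((measurable_dotProduct_mulVec hA hy hy).mul h1)
    ((measurable_dotProduct_mulVec hA hy hX).pow_const 2)).inter
    (h1 (measurableSet_singleton 0).compl)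

end Measurability

/-! ### Gaussian vectors and chi-squared laws -/

section Gaussian

/-- The law of a vector of independent standard normal variables. -/
noncomputable abbrev stdNormalPi (ι : Type*) [Fintype ι] : Measure (ι → ℝ) :=
  Measure.pi fun _ : ι => gaussianReal 0 1

/-- Needed for the support of the limit of λ₁; Lebesgue measure is absolutely continuous with
respect to the standard normal law. -/
instance isOpenPosMeasure_gaussianReal : (gaussianReal 0 1).IsOpenPosMeasure :=
  (gaussianReal_absolutelyContinuous' 0 one_ne_zero).isOpenPosMeasure

/-- Moving `M` across the inner product shows that both characteristic functions are exp(-|Mᵀt|²/2).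
-/
theorem stdGaussian_map_toEuclideanCLM {ι : Type*} [Fintype ι] [DecidableEq ι]
    (M : Matrix ι ι ℝ) :
    (stdGaussian (EuclideanSpace ℝ ι)).map (toEuclideanCLM (𝕜 := ℝ) M) =
      multivariateGaussian 0 (M * Mᵀ) := by
  have hpsd : (M * Mᵀ).PosSemidef := by
    have := Matrix.posSemidef_self_mul_conjTranspose M
    rwa [Matrix.conjTranspose_eq_transpose_of_trivial] at this
  have hprob : IsProbabilityMeasure ((stdGaussian (EuclideanSpace ℝ ι)).map
      (toEuclideanCLM (𝕜 := ℝ) M)) :=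
    Measure.isProbabilityMeasure_map (by fun_prop)
  refine Measure.ext_of_charFun (E := EuclideanSpace ℝ ι) (funext fun t => ?_)
  have hadj : ∀ x : EuclideanSpace ℝ ι, inner ℝ (toEuclideanCLM (𝕜 := ℝ) M x) t =
      inner ℝ x (toEuclideanCLM (𝕜 := ℝ) Mᵀ t) := fun x => by
    rw [real_inner_comm, inner_toEuclideanCLM, inner_toEuclideanCLM, Matrix.dotProduct_mulVec,
      ← Matrix.mulVec_transpose, dotProduct_comm]
  have hnorm : ‖toEuclideanCLM (𝕜 := ℝ) Mᵀ t‖ ^ 2 = t ⬝ᵥ (M * Mᵀ) *ᵥ t := by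
    rw [← real_inner_self_eq_norm_sq, ← hadj, real_inner_comm, inner_toEuclideanCLM,
      ofLp_toEuclideanCLM, Matrix.mulVec_mulVec]
  rw [charFun_multivariateGaussian hpsd, charFun_apply, integral_map (by fun_prop) (by fun_prop)]
  simp_rw [hadj]
  rw [← charFun_apply, charFun_stdGaussian, inner_zero_right, ← hnorm]
  congr 1
  push_cast
  ring

/-- Two independent standard normal vectors stacked form a standard normal vector. -/
theorem map_prod_stdNormalPi (k : ℕ) :
    ((stdNormalPi (Fin k)).prod (stdNormalPi (Fin k))).map
      (fun p => fun a : Fin 2 × Fin k => ![p.1 a.2, p.2 a.2] a.1) =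
    stdNormalPi (Fin 2 × Fin k) := by
  have hm : Measurable fun (p : (Fin k → ℝ) × (Fin k → ℝ)) =>
      fun a : Fin 2 × Fin k => ![p.1 a.2, p.2 a.2] a.1 := by
    refine measurable_pi_lambda _ fun ⟨a, i⟩ => ?_
    fin_cases a
    · exact (measurable_pi_apply i).comp measurable_fst
    · exact (measurable_pi_apply i).comp measurable_snd
  refine (Measure.pi_eq fun s hs => ?_).symm
  rw [Measure.map_apply hm (MeasurableSet.univ_pi hs)]
  have : (fun (p : (Fin k → ℝ) × (Fin k → ℝ)) =>
      fun a : Fin 2 × Fin k => ![p.1 a.2, p.2 a.2] a.1) ⁻¹' (Set.univ.pi s) =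
      (Set.univ.pi fun i => s (0, i)) ×ˢ (Set.univ.pi fun i => s (1, i)) := by
    ext p
    simp [Set.mem_pi, Fin.forall_fin_two, Prod.forall]
  rw [this, Measure.prod_prod, Measure.pi_pi, Measure.pi_pi, Fintype.prod_prod_type,
    Fin.prod_univ_two]

/-- A centred Gaussian vector with covariance `(B Bᵀ) ⊗ Id` as a linear image of two independent
standard normal vectors. -/
theorem multivariateGaussian_kronecker_eq_map {k : ℕ} (B : Matrix (Fin 2) (Fin 2) ℝ) :
    multivariateGaussian 0 ((B * Bᵀ) ⊗ₖ (1 : Matrix (Fin k) (Fin k) ℝ)) =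
      ((stdNormalPi (Fin k)).prod (stdNormalPi (Fin k))).map (fun p => WithLp.toLp 2
        fun a : Fin 2 × Fin k => B a.1 0 * p.1 a.2 + B a.1 1 * p.2 a.2) := by
  have h : (B * Bᵀ) ⊗ₖ (1 : Matrix (Fin k) (Fin k) ℝ) =
      (B ⊗ₖ (1 : Matrix (Fin k) (Fin k) ℝ)) * (B ⊗ₖ (1 : Matrix (Fin k) (Fin k) ℝ))ᵀ := by
    rw [← Matrix.kroneckerMap_transpose, Matrix.transpose_one, ← Matrix.mul_kronecker_mul, mul_one]
  have hm : Measurable fun (p : (Fin k → ℝ) × (Fin k → ℝ)) =>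
      fun a : Fin 2 × Fin k => ![p.1 a.2, p.2 a.2] a.1 := by
    refine measurable_pi_lambda _ fun ⟨a, i⟩ => ?_
    fin_cases a
    · exact (measurable_pi_apply i).comp measurable_fst
    · exact (measurable_pi_apply i).comp measurable_snd
  have hstd : (stdNormalPi (Fin 2 × Fin k)).map (WithLp.toLp 2) =
      stdGaussian (EuclideanSpace ℝ (Fin 2 × Fin k)) := map_pi_eq_stdGaussian
  rw [h, ← stdGaussian_map_toEuclideanCLM, ← hstd, ← map_prod_stdNormalPi,
    Measure.map_map (by fun_prop) hm, Measure.map_map (by fun_prop) (by fun_prop)]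
  congr 1
  ext p a
  obtain ⟨a, i⟩ := a
  simp [toEuclideanCLM_toLp, Matrix.mulVec, dotProduct, Fintype.sum_prod_type,
    Matrix.kroneckerMap_apply, Matrix.one_apply]

theorem measurable_sum_sq {ι : Type*} [Fintype ι] :
    Measurable fun x : ι → ℝ => ∑ i, x i ^ 2 :=
  Finset.measurable_sum _ fun i _ => (measurable_pi_apply i).pow_const 2

theorem chiSquared_one_eq : chiSquared 1 = (gaussianReal 0 1).map fun x => x ^ 2 := by
  have h := (measurePreserving_funUnique (gaussianReal 0 1) (Fin 1)).map_eq
  rw [← h, Measure.map_map (by fun_prop) (by fun_prop), chiSquared]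
  congr 1
  ext x
  simp [MeasurableEquiv.funUnique]

/-- The squared length of a standard normal vector splits, along a unit vector and its orthogonal
complement, into independent chi-squared variables. -/
theorem map_stdNormalPi_sq_split {d : ℕ} {u : Fin (d + 1) → ℝ} (hu : u ⬝ᵥ u = 1) :
    (stdNormalPi (Fin (d + 1))).map (fun x => (x ⬝ᵥ x - (x ⬝ᵥ u) ^ 2, (x ⬝ᵥ u) ^ 2)) =
      (chiSquared d).prod (chiSquared 1) := by
  have hortho : Orthonormal ℝ (({0} : Set (Fin (d + 1))).domRestrict
      fun _ => (WithLp.toLp 2 u : EuclideanSpace ℝ (Fin (d + 1)))) := by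
    refine ⟨fun i => ?_, fun i j hij => absurd (Subsingleton.elim i j) hij⟩
    rw [Set.domRestrict_apply, EuclideanSpace.norm_eq, Real.sqrt_eq_one]
    simpa [dotProduct, sq] using hu
  obtain ⟨b, hb⟩ := hortho.exists_orthonormalBasis_extension_of_card_eq (by simp)
  have hb0 := hb 0 rfl
  let f₀ : EuclideanSpace ℝ (Fin (d + 1)) → ℝ × ℝ := fun z => (‖z‖ ^ 2 - (z 0) ^ 2, (z 0) ^ 2)
  have hf₀ : Measurable f₀ := by fun_prop
  -- In an orthonormal basis starting with `u`, coordinate 0 is `x ⬝ᵥ u`, and the coordinates are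
  -- again standard normal.
  have e1 : (fun x : Fin (d + 1) → ℝ => (x ⬝ᵥ x - (x ⬝ᵥ u) ^ 2, (x ⬝ᵥ u) ^ 2)) =
      f₀ ∘ b.repr ∘ WithLp.toLp 2 := by
    ext x : 1
    have h1 : b.repr (WithLp.toLp 2 x) 0 = x ⬝ᵥ u := by
      rw [b.repr_apply_apply, hb0, EuclideanSpace.inner_toLp_toLp]
      simp
    have h2 : ‖b.repr (WithLp.toLp 2 x)‖ ^ 2 = x ⬝ᵥ x := by
      rw [LinearIsometryEquiv.norm_map, EuclideanSpace.norm_sq_eq]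
      simp [dotProduct, sq]
    simp only [f₀, Function.comp_apply, h1, h2]
  have e2 : f₀ ∘ WithLp.toLp 2 = (fun p : ℝ × (Fin d → ℝ) => (∑ i, p.2 i ^ 2, p.1 ^ 2)) ∘
      MeasurableEquiv.piFinSuccAbove (fun _ : Fin (d + 1) => ℝ) 0 := by
    ext x : 1
    simp [f₀, EuclideanSpace.norm_sq_eq, Fin.sum_univ_succ, MeasurableEquiv.piFinSuccAbove,
      Fin.tail]
  have hm : Measurable fun p : ℝ × (Fin d → ℝ) => (∑ i, p.2 i ^ 2, p.1 ^ 2) :=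
    (measurable_sum_sq.comp measurable_snd).prodMk (measurable_fst.pow_const 2)
  have hR : Measurable b.repr := b.repr.continuous.measurable
  rw [e1, ← Measure.map_map hf₀ (hR.comp (by fun_prop)), ← Measure.map_map hR (by fun_prop),
    map_pi_eq_stdGaussian, stdGaussian_map, ← map_pi_eq_stdGaussian,
    Measure.map_map hf₀ (by fun_prop), e2, ← Measure.map_map hm (by fun_prop),
    (measurePreserving_piFinSuccAbove (fun _ : Fin (d + 1) => gaussianReal 0 1) 0).map_eq,
    chiSquared_one_eq, chiSquared, ← Measure.prod_swap,
    Measure.map_prod_map _ _ measurable_sum_sq (by fun_prop),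
    Measure.map_map (by fun_prop) (by fun_prop)]
  rfl

end Gaussian

/-! ### The limit law and its conditional structure -/

section LimitLaw

theorem continuous_gammaFun : Continuous fun p : ℝ × ℝ × ℝ => gammaFun p.1 p.2.1 p.2.2 := by
  unfold gammaFun
  fun_prop

/-- The larger of the two solutions `t` of `t (t - (q - l)) = s`. -/
noncomputable def upperRoot (q l s : ℝ) : ℝ :=
  (1 / 2) * (q - l + √((q - l) ^ 2 + 4 * s))

/-- The discriminants agree: (q₀ + q₁ + l)² - 4 q₀ l = (q₀ + q₁ - l)² + 4 l q₁. -/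
theorem gammaFun_eq_upperRoot (l q₀ q₁ : ℝ) :
    gammaFun l q₀ q₁ = upperRoot (q₀ + q₁) l (l * q₁) := by
  rw [gammaFun, upperRoot]
  ring_nf

theorem continuous_dotProduct {ι : Type*} [Fintype ι] :
    Continuous fun p : (ι → ℝ) × (ι → ℝ) => p.1 ⬝ᵥ p.2 := by
  unfold dotProduct
  fun_prop

/-- For a fixed vector `w`, the law of the likelihood-ratio limit in a standard normal vector. -/
theorem map_stdNormalPi_upperRoot {k : ℕ} (hk : 0 < k) (w : Fin k → ℝ) :
    (stdNormalPi (Fin k)).map (fun x => upperRoot (x ⬝ᵥ x) (w ⬝ᵥ w) ((x ⬝ᵥ w) ^ 2)) =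
      ((chiSquared (k - 1)).prod (chiSquared 1)).map
        fun q => gammaFun (w ⬝ᵥ w) q.1 q.2 := by
  obtain ⟨d, rfl⟩ := Nat.exists_eq_succ_of_ne_zero hk.ne'
  simp only [Nat.succ_eq_add_one, Nat.add_sub_cancel] at *
  obtain ⟨u, hu, c, rfl⟩ : ∃ u : Fin (d + 1) → ℝ, u ⬝ᵥ u = 1 ∧ ∃ c : ℝ, w = c • u := by
    by_cases hw : w = 0
    -- For `w = 0` any unit vector serves as direction.
    · exact ⟨Pi.single 0 1, by simp, 0, by simp [hw]⟩
    · have hpos : 0 < w ⬝ᵥ w := by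
        refine lt_of_le_of_ne (by simpa using dotProduct_star_self_nonneg w) fun h => hw ?_
        simpa using h.symm
      have hne : √(w ⬝ᵥ w) ≠ 0 := (Real.sqrt_pos.2 hpos).ne'
      refine ⟨(√(w ⬝ᵥ w))⁻¹ • w, ?_, √(w ⬝ᵥ w), ?_⟩
      · rw [smul_dotProduct, dotProduct_smul, smul_eq_mul, smul_eq_mul, ← mul_assoc,
          ← mul_inv, Real.mul_self_sqrt hpos.le, inv_mul_cancel₀ hpos.ne']
      · rw [smul_smul, mul_inv_cancel₀ hne, one_smul]
  have hd : Continuous fun x : Fin (d + 1) → ℝ => x ⬝ᵥ u :=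
    continuous_dotProduct.comp (by fun_prop : Continuous fun x => (x, u))
  have hd' : Continuous fun x : Fin (d + 1) → ℝ => x ⬝ᵥ x :=
    continuous_dotProduct.comp (by fun_prop : Continuous fun x => (x, x))
  have hg : Continuous fun q : ℝ × ℝ => gammaFun ((c • u) ⬝ᵥ (c • u)) q.1 q.2 :=
    continuous_gammaFun.comp (Continuous.prodMk_right _)
  have hsplit : Continuous fun x : Fin (d + 1) → ℝ => (x ⬝ᵥ x - (x ⬝ᵥ u) ^ 2, (x ⬝ᵥ u) ^ 2) :=
    (hd'.sub (hd.pow 2)).prodMk (hd.pow 2)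
  rw [← map_stdNormalPi_sq_split hu, Measure.map_map hg.measurable hsplit.measurable]
  congr 1
  ext x
  rw [Function.comp_apply, gammaFun_eq_upperRoot, sub_add_cancel]
  simp only [smul_dotProduct, dotProduct_smul, smul_eq_mul, hu]
  ring_nf

/-- The joint law of the limits of the conditioning and the likelihood-ratio statistics. -/
theorem map_prod_stdNormalPi_upperRoot {k : ℕ} (hk : 0 < k) (m : Fin k → ℝ) :
    ((stdNormalPi (Fin k)).prod (stdNormalPi (Fin k))).map
      (fun p => ((m + p.2) ⬝ᵥ (m + p.2),
        upperRoot (p.1 ⬝ᵥ p.1) ((m + p.2) ⬝ᵥ (m + p.2)) ((p.1 ⬝ᵥ (m + p.2)) ^ 2))) =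
    (((stdNormalPi (Fin k)).map fun z => (m + z) ⬝ᵥ (m + z)).prod
      ((chiSquared (k - 1)).prod (chiSquared 1))).map
        fun p => (p.1, gammaFun p.1 p.2.1 p.2.2) := by
  have hl : Measurable fun z : Fin k → ℝ => (m + z) ⬝ᵥ (m + z) :=
    (continuous_dotProduct.comp (by fun_prop : Continuous fun z => (m + z, m + z))).measurable
  have hx : Measurable fun x : Fin k → ℝ => x ⬝ᵥ x :=
    (continuous_dotProduct.comp (by fun_prop : Continuous fun x => (x, x))).measurable
  have hxz : Measurable fun p : (Fin k → ℝ) × (Fin k → ℝ) => p.1 ⬝ᵥ (m + p.2) :=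
    (continuous_dotProduct.comp (by fun_prop :
      Continuous fun p : (Fin k → ℝ) × (Fin k → ℝ) => (p.1, m + p.2))).measurable
  have hu : Measurable fun p : ℝ × ℝ × ℝ => upperRoot p.1 p.2.1 p.2.2 := by
    unfold upperRoot
    fun_prop
  have hY : Measurable fun p : (Fin k → ℝ) × (Fin k → ℝ) =>
      upperRoot (p.1 ⬝ᵥ p.1) ((m + p.2) ⬝ᵥ (m + p.2)) ((p.1 ⬝ᵥ (m + p.2)) ^ 2) :=
    hu.comp ((hx.comp measurable_fst).prodMk ((hl.comp measurable_snd).prodMk (hxz.pow_const 2)))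
  have hG : Measurable fun p : ℝ × ℝ × ℝ => (p.1, gammaFun p.1 p.2.1 p.2.2) :=
    measurable_fst.prodMk continuous_gammaFun.measurable
  have hLY : Measurable fun p : (Fin k → ℝ) × (Fin k → ℝ) => ((m + p.2) ⬝ᵥ (m + p.2),
      upperRoot (p.1 ⬝ᵥ p.1) ((m + p.2) ⬝ᵥ (m + p.2)) ((p.1 ⬝ᵥ (m + p.2)) ^ 2)) :=
    (hl.comp measurable_snd).prodMk hY
  ext s hs
  -- Fubini reduces the claim to a fixed `z`, where the fixed-vector law applies with `w = m + z`.
  rw [Measure.map_apply hLY hs, Measure.map_apply hG hs, Measure.prod_apply_symm (hLY hs),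
    Measure.prod_apply (hG hs), lintegral_map (measurable_measure_prodMk_left (hG hs)) hl]
  refine lintegral_congr fun z => ?_
  have hs' : MeasurableSet {t : ℝ | ((m + z) ⬝ᵥ (m + z), t) ∈ s} := measurable_prodMk_left hs
  have h := congrArg (fun μ => μ {t : ℝ | ((m + z) ⬝ᵥ (m + z), t) ∈ s})
    (map_stdNormalPi_upperRoot hk (m + z))
  have h1 : Measurable fun x : Fin k → ℝ =>
      upperRoot (x ⬝ᵥ x) ((m + z) ⬝ᵥ (m + z)) ((x ⬝ᵥ (m + z)) ^ 2) :=
    hY.comp measurable_prodMk_right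
  have h2 : Measurable fun q : ℝ × ℝ => gammaFun ((m + z) ⬝ᵥ (m + z)) q.1 q.2 :=
    (continuous_gammaFun.comp (Continuous.prodMk_right _)).measurable
  beta_reduce at h
  rw [Measure.map_apply h1 hs', Measure.map_apply h2 hs'] at h
  exact h

/-- The noncentral chi-squared distribution has no atoms. -/
theorem map_stdNormalPi_sq_add_singleton {k : ℕ} (hk : 0 < k) (m : Fin k → ℝ) (c : ℝ) :
    (stdNormalPi (Fin k)).map (fun z => (m + z) ⬝ᵥ (m + z)) {c} = 0 := by
  obtain ⟨d, rfl⟩ := Nat.exists_eq_succ_of_ne_zero hk.ne'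
  have hl : Measurable fun z : Fin (d + 1) → ℝ => (m + z) ⬝ᵥ (m + z) :=
    (continuous_dotProduct.comp (by fun_prop : Continuous fun z => (m + z, m + z))).measurable
  have hna : NullSingletonClass (gaussianReal 0 1) := nullSingletonClass_gaussianReal one_ne_zero
  have hmp : MeasurePreserving (MeasurableEquiv.piFinSuccAbove (fun _ : Fin (d + 1) => ℝ) 0).symm
      ((gaussianReal 0 1).prod (stdNormalPi (Fin d))) (stdNormalPi (Fin (d + 1))) :=
    (measurePreserving_piFinSuccAbove (fun _ : Fin (d + 1) => gaussianReal 0 1) 0).symm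
  rw [Measure.map_apply hl (measurableSet_singleton c), ← hmp.map_eq,
    Measure.map_apply hmp.measurable (hl (measurableSet_singleton c)),
    Measure.prod_apply_symm (hmp.measurable (hl (measurableSet_singleton c)))]
  refine (lintegral_congr fun r => ?_).trans lintegral_zero
  -- With the other coordinates fixed, the equation is quadratic in coordinate 0 and has at most two
  -- solutions.
  refine Set.Finite.measure_zero (Set.Finite.subset (s :=
    {√(c - ∑ i : Fin d, (m i.succ + r i) ^ 2) - m 0,
      -√(c - ∑ i : Fin d, (m i.succ + r i) ^ 2) - m 0}) (by simp) fun t ht => ?_) _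
  have ht' : (m 0 + t) ^ 2 + ∑ i : Fin d, (m i.succ + r i) ^ 2 = c := by
    simpa [dotProduct, Fin.sum_univ_succ, MeasurableEquiv.piFinSuccAbove, sq] using ht
  have h2 : (m 0 + t) ^ 2 = √(c - ∑ i : Fin d, (m i.succ + r i) ^ 2) ^ 2 := by
    rw [Real.sq_sqrt (by rw [← ht']; simpa using sq_nonneg _)]
    linarith
  rcases sq_eq_sq_iff_eq_or_eq_neg.1 h2 with h | h
  · left; linarith
  · right; simp only [Set.mem_singleton_iff]; linarith

/-- The noncentral chi-squared distribution charges every neighbourhood of every nonnegative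
point. -/
theorem map_stdNormalPi_sq_add_pos {k : ℕ} (hk : 0 < k) (m : Fin k → ℝ) {l₀ δ : ℝ} (hl₀ : 0 ≤ l₀)
    (hδ : 0 < δ) :
    0 < (stdNormalPi (Fin k)).map (fun z => (m + z) ⬝ᵥ (m + z)) {l | |l - l₀| < δ} := by
  have hl : Continuous fun z : Fin k → ℝ => (m + z) ⬝ᵥ (m + z) :=
    continuous_dotProduct.comp (by fun_prop : Continuous fun z => (m + z, m + z))
  have ho : IsOpen {l : ℝ | |l - l₀| < δ} := isOpen_lt (by fun_prop) (by fun_prop)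
  rw [Measure.map_apply hl.measurable ho.measurableSet]
  -- This point is sent exactly to `l₀`, so the open preimage is nonempty.
  refine (ho.preimage hl).measure_pos _ ⟨Pi.single ⟨0, hk⟩ (√l₀) - m, ?_⟩
  simp only [Set.mem_preimage, Set.mem_ofPred_eq, add_sub_cancel]
  simpa [Real.mul_self_sqrt hl₀] using hδ

end LimitLaw

/-! ### The pair of statistics as a function of form entries -/

section Assembly

/-- Only the law of the limit matters, so the limit variable may be realized on another probability
space. -/
theorem MeasureTheory.TendstoInDistribution.of_map_eq {Ω Ω' Ω'' E : Type*} [MeasurableSpace Ω]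
    [MeasurableSpace Ω'] [MeasurableSpace Ω''] [TopologicalSpace E] [MeasurableSpace E]
    [OpensMeasurableSpace E] {P : Measure Ω} [IsProbabilityMeasure P] {P' : Measure Ω'}
    [IsProbabilityMeasure P'] {P'' : Measure Ω''} [IsProbabilityMeasure P'']
    {X : ℕ → Ω → E} {X' : Ω' → E} {X'' : Ω'' → E}
    (h : TendstoInDistribution X atTop X' (fun _ => P) P') (hX'' : AEMeasurable X'' P'')
    (heq : P'.map X' = P''.map X'') : TendstoInDistribution X atTop X'' (fun _ => P) P'' where
  forall_aemeasurable := h.forall_aemeasurable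
  aemeasurable_limit := hX''
  tendsto := by
    have h1 := h.tendsto
    have h2 : (⟨P'.map X', Measure.isProbabilityMeasure_map h.aemeasurable_limit⟩ :
        ProbabilityMeasure E) = ⟨P''.map X'', Measure.isProbabilityMeasure_map hX''⟩ :=
      Subtype.ext heq
    rw [h2] at h1
    exact h1

/-- Union bound: the sup distance reaches `δ` only if some coordinate distance does. -/
theorem tendstoInMeasure_pi {Ω ι : Type*} [Fintype ι] {E : ι → Type*} [MeasurableSpace Ω]
    [∀ i, PseudoEMetricSpace (E i)] {P : Measure Ω} {f : ℕ → Ω → ∀ i, E i} {g : Ω → ∀ i, E i}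
    (h : ∀ i, TendstoInMeasure P (fun n ω => f n ω i) atTop fun ω => g ω i) :
    TendstoInMeasure P f atTop g := by
  intro δ hδ
  have hsum : Tendsto (fun n => ∑ i, P {ω | δ ≤ edist (f n ω i) (g ω i)}) atTop (𝓝 0) := by
    simpa using tendsto_finsetSum Finset.univ fun i _ => h i δ hδ
  refine tendsto_of_tendsto_of_tendsto_of_le_of_le tendsto_const_nhds hsum (fun _ => zero_le)
    fun n => ?_
  refine (measure_mono fun ω hω => ?_).trans (measure_iUnion_fintype_le P
    fun i => {ω | δ ≤ edist (f n ω i) (g ω i)})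
  by_contra hcon
  simp only [Set.mem_iUnion, Set.mem_ofPred_eq, not_exists, not_le] at hcon
  refine absurd (show δ ≤ edist (f n ω) (g ω) from hω) (not_le.2 ?_)
  rw [edist_pi_def, Finset.sup_lt_iff (by simpa using hδ)]
  exact fun i _ => hcon i

theorem mul_upperRoot {c : ℝ} (hc : 0 ≤ c) (q l s : ℝ) :
    c * upperRoot q l s = upperRoot (c * q) (c * l) (c ^ 2 * s) := by
  have : (c * q - c * l) ^ 2 + 4 * (c ^ 2 * s) = c ^ 2 * ((q - l) ^ 2 + 4 * s) := by ring
  rw [upperRoot, upperRoot, this, Real.sqrt_mul (sq_nonneg c), Real.sqrt_sq hc]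
  ring

/-- The pair (conditioning statistic, likelihood-ratio statistic) as a function of the entries of
the projected form (`a`, `b`, `d`) and of the residual form (`a'`, `b'`, `d'`). -/
noncomputable def statPair (c a b d a' b' d' : ℝ) : ℝ × ℝ :=
  (c * ((d - 2 * (b' / a') * b + (b' / a') ^ 2 * a) / (d' - b' ^ 2 / a')),
    upperRoot (c * (a / a'))
      (c * ((d - 2 * (b' / a') * b + (b' / a') ^ 2 * a) / (d' - b' ^ 2 / a')))
      (c ^ 2 * ((b - b' / a' * a) ^ 2 / (a' * (d' - b' ^ 2 / a')))))

/-- The residual form grows like n; this moves the factor n into the prefactor, turning n - k into 1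
- k/n. -/
theorem statPair_mul {t : ℝ} (ht : t ≠ 0) (c a b d a' b' d' : ℝ) :
    statPair c a b d (t * a') (t * b') (t * d') = statPair (c / t) a b d a' b' d' := by
  have h1 : t * b' / (t * a') = b' / a' := mul_div_mul_left _ _ ht
  have h2 : t * d' - (t * b') ^ 2 / (t * a') = t * (d' - b' ^ 2 / a') := by
    rw [mul_pow, sq t, mul_assoc t t, mul_div_mul_left _ _ ht]
    ring
  have h3 : ∀ x y : ℝ, c * (x / (t * y)) = c / t * (x / y) := fun x y => by
    rw [div_mul_div_comm, mul_div_assoc]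
  have h4 : ∀ x y z : ℝ, c ^ 2 * (x / (t * y * (t * z))) = (c / t) ^ 2 * (x / (y * z)) :=
    fun x y z => by
      rw [div_pow, div_mul_div_comm, mul_div_assoc, show t * y * (t * z) = t ^ 2 * (y * z) by ring]
  simp only [statPair, h1, h2, h3, h4]

theorem continuousOn_statPair {E : Type*} [TopologicalSpace E] {c a b d a' b' d' : E → ℝ}
    (hc : Continuous c) (ha : Continuous a) (hb : Continuous b) (hd : Continuous d)
    (ha' : Continuous a') (hb' : Continuous b') (hd' : Continuous d') {U : Set E}
    (h1 : ∀ x ∈ U, a' x ≠ 0) (h2 : ∀ x ∈ U, d' x - b' x ^ 2 / a' x ≠ 0) :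
    ContinuousOn (fun x => statPair (c x) (a x) (b x) (d x) (a' x) (b' x) (d' x)) U := by
  have hr : ContinuousOn (fun x => b' x / a' x) U := hb'.continuousOn.div ha'.continuousOn h1
  have hm : ContinuousOn (fun x => d' x - b' x ^ 2 / a' x) U :=
    hd'.continuousOn.sub ((hb'.pow 2).continuousOn.div ha'.continuousOn h1)
  have hl : ContinuousOn (fun x => c x * ((d x - 2 * (b' x / a' x) * b x +
      (b' x / a' x) ^ 2 * a x) / (d' x - b' x ^ 2 / a' x))) U :=
    hc.continuousOn.mul (ContinuousOn.div (by fun_prop) hm h2)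
  have hq : ContinuousOn (fun x => c x * (a x / a' x)) U :=
    hc.continuousOn.mul (ha.continuousOn.div ha'.continuousOn h1)
  have hs : ContinuousOn (fun x => c x ^ 2 * ((b x - b' x / a' x * a x) ^ 2 /
      (a' x * (d' x - b' x ^ 2 / a' x)))) U :=
    (hc.pow 2).continuousOn.mul (ContinuousOn.div (by fun_prop) (ha'.continuousOn.mul hm)
      fun x hx => mul_ne_zero (h1 x hx) (h2 x hx))
  have hu : Continuous fun p : ℝ × ℝ × ℝ => upperRoot p.1 p.2.1 p.2.2 := by
    unfold upperRoot
    fun_prop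
  exact hl.prodMk (hu.comp_continuousOn (hq.prodMk (hl.prodMk hs)))

theorem lambdaStat_lrStat_eq_statPair {n k : ℕ} (hkn : k ≤ n) (Z : Matrix (Fin n) (Fin k) ℝ)
    (X e : Fin n → ℝ) (β : ℝ) {a b d a' b' d' : ℝ}
    (ha : e ⬝ᵥ projZ Z *ᵥ e = a) (hb : e ⬝ᵥ projZ Z *ᵥ X = b) (hd : X ⬝ᵥ projZ Z *ᵥ X = d)
    (ha' : e ⬝ᵥ annZ Z *ᵥ e = a') (hb' : e ⬝ᵥ annZ Z *ᵥ X = b') (hd' : X ⬝ᵥ annZ Z *ᵥ X = d')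
    (h1 : 0 < a') (h2 : 0 < d' - b' ^ 2 / a') :
    (lambdaStat Z X (β • X + e) β, lrStat Z X (β • X + e) β) =
      statPair ((n : ℝ) - k) a b d a' b' d' := by
  rw [lambdaStat_eq Z X e β ha hb hd ha' hb' hd' h1, lrStat_eq Z X e β ha hb hd ha' hb' hd' h1 h2,
    statPair, ← mul_upperRoot (sub_nonneg.2 (Nat.cast_le.2 hkn)), upperRoot]

/-- Regressing on `α • x` with coefficient `r` leaves `σ • v` with residual variance `σ ^ 2`, so all
three parameters cancel. -/
theorem statPair_limit {k : ℕ} {α σ r : ℝ} (hα : α ≠ 0) (hσ : σ ≠ 0) (x v : Fin k → ℝ) :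
    statPair 1 ((α • x) ⬝ᵥ (α • x)) ((α • x) ⬝ᵥ (r • α • x + σ • v))
      ((r • α • x + σ • v) ⬝ᵥ (r • α • x + σ • v)) (α ^ 2) (r * α ^ 2) (σ ^ 2 + r ^ 2 * α ^ 2) =
    (v ⬝ᵥ v, upperRoot (x ⬝ᵥ x) (v ⬝ᵥ v) ((x ⬝ᵥ v) ^ 2)) := by
  have h1 : r * α ^ 2 / α ^ 2 = r := by field_simp
  have h2 : σ ^ 2 + r ^ 2 * α ^ 2 - (r * α ^ 2) ^ 2 / α ^ 2 = σ ^ 2 := by field_simp; ring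
  simp only [statPair, h1, h2, smul_dotProduct, dotProduct_smul, dotProduct_add, add_dotProduct,
    smul_eq_mul, one_mul, one_pow, dotProduct_comm v x]
  generalize x ⬝ᵥ x = A, x ⬝ᵥ v = B, v ⬝ᵥ v = C
  congr 1
  · field_simp
    ring
  · congr 1
    · field_simp
    · field_simp
      ring
    · field_simp
      ring

end Assembly

/-! ### The state of a sample -/

section ModelState

/-- The random quantities with joint limits: the vector `vec Ψ`, the error moments, the instrument
moments, and the reciprocal of the sample size. -/
abbrev ModelState (k : ℕ) : Type :=
  ((EuclideanSpace ℝ (Fin 2 × Fin k) × (Fin 2 → Fin 2 → ℝ)) × (Fin k → Fin k → ℝ)) × ℝ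

namespace ModelState

variable {k : ℕ}

/-- The `a`-th column of `Ψ`. -/
def psi (x : ModelState k) (a : Fin 2) : Fin k → ℝ := fun i => x.1.1.1 (a, i)

/-- The normalised projection of the endogenous variable. -/
noncomputable def proj (Pi₀ : Fin k → ℝ) (x : ModelState k) : Fin k → ℝ :=
  cfc Real.sqrt ((1 / 2 : ℝ) • (Matrix.of x.1.2 + (Matrix.of x.1.2)ᵀ)) *ᵥ Pi₀ + psi x 1

/-- The residual moments of the errors. -/
def resid (x : ModelState k) (a b : Fin 2) : ℝ := x.1.1.2 a b - x.2 * (psi x a ⬝ᵥ psi x b)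

/-- The pair of statistics as a function of the state. -/
noncomputable def stat (Pi₀ : Fin k → ℝ) (x : ModelState k) : ℝ × ℝ :=
  statPair (1 - k * x.2) (psi x 0 ⬝ᵥ psi x 0) (psi x 0 ⬝ᵥ proj Pi₀ x) (proj Pi₀ x ⬝ᵥ proj Pi₀ x)
    (resid x 0 0) (resid x 0 1) (resid x 1 1)

/-- The states at which the statistics are given by `ModelState.stat`. -/
def regular (k : ℕ) : Set (ModelState k) :=
  {x | 0 < resid x 0 0 ∧ 0 < resid x 0 0 * resid x 1 1 - resid x 0 1 ^ 2 ∧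
    (Matrix.of x.1.2).det ≠ 0}

theorem continuous_psi (a : Fin 2) : Continuous fun x : ModelState k => psi x a := by
  unfold psi
  fun_prop

theorem continuous_proj (Pi₀ : Fin k → ℝ) : Continuous fun x : ModelState k => proj Pi₀ x := by
  refine Continuous.add ?_ (continuous_psi 1)
  have h : Continuous fun x : ModelState k => (Matrix.of x.1.2 : Matrix (Fin k) (Fin k) ℝ) :=
    continuous_snd.comp continuous_fst
  exact (continuous_cfc_sqrt_symm.comp h).matrix_mulVec continuous_const

theorem continuous_dotProduct_comp {E ι : Type*} [Fintype ι] [TopologicalSpace E]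
    {f g : E → ι → ℝ} (hf : Continuous f) (hg : Continuous g) :
    Continuous fun x => f x ⬝ᵥ g x :=
  continuous_dotProduct.comp (hf.prodMk hg)

theorem continuous_resid (a b : Fin 2) : Continuous fun x : ModelState k => resid x a b := by
  have h := continuous_dotProduct_comp (continuous_psi (k := k) a) (continuous_psi b)
  unfold resid
  fun_prop

theorem isOpen_regular : IsOpen (regular k) := by
  have h : Continuous fun x : ModelState k => (Matrix.of x.1.2).det := by
    have h : Continuous fun x : ModelState k => (Matrix.of x.1.2 : Matrix (Fin k) (Fin k) ℝ) :=
      continuous_snd.comp continuous_fst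
    exact h.matrix_det
  exact (isOpen_lt continuous_const (continuous_resid 0 0)).inter
    ((isOpen_lt continuous_const (((continuous_resid 0 0).mul (continuous_resid 1 1)).sub
      ((continuous_resid 0 1).pow 2))).inter (isOpen_ne_fun h continuous_const))

theorem schur_pos {x : ModelState k} (hx : x ∈ regular k) :
    0 < resid x 1 1 - resid x 0 1 ^ 2 / resid x 0 0 := by
  have h : resid x 1 1 - resid x 0 1 ^ 2 / resid x 0 0 =
      (resid x 0 0 * resid x 1 1 - resid x 0 1 ^ 2) / resid x 0 0 := by
    have := hx.1.ne'
    field_simp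
  rw [h]
  exact div_pos hx.2.1 hx.1

theorem continuousOn_stat (Pi₀ : Fin k → ℝ) : ContinuousOn (stat Pi₀) (regular k) :=
  continuousOn_statPair (by fun_prop)
    (continuous_dotProduct_comp (continuous_psi 0) (continuous_psi 0))
    (continuous_dotProduct_comp (continuous_psi 0) (continuous_proj Pi₀))
    (continuous_dotProduct_comp (continuous_proj Pi₀) (continuous_proj Pi₀))
    (continuous_resid 0 0) (continuous_resid 0 1) (continuous_resid 1 1)
    (fun _ hx => hx.1.ne') (fun _ hx => (schur_pos hx).ne')

/-- The state of a sample. -/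
noncomputable def ofSample {n : ℕ} (Z : Matrix (Fin n) (Fin k) ℝ) (ε V : Fin n → ℝ) :
    ModelState k :=
  (((WithLp.toLp 2 (psiMatrix Z ε V).vec,
    fun a b => ((n : ℝ)⁻¹ • ((errorMatrix ε V)ᵀ * errorMatrix ε V)) a b),
    fun i j => ((n : ℝ)⁻¹ • (Zᵀ * Z)) i j), (n : ℝ)⁻¹)

/-- In a regular sample the two statistics are functions of the state. -/
theorem lambdaStat_lrStat_eq_stat {n : ℕ} (hn : 0 < n) (hkn : k ≤ n)
    (Z : Matrix (Fin n) (Fin k) ℝ) (ε V : Fin n → ℝ) (p : Fin k → ℝ) (β : ℝ)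
    (h : ofSample Z ε V ∈ regular k) :
    (lambdaStat Z (Z *ᵥ p + V) (β • (Z *ᵥ p + V) + ε) β,
      lrStat Z (Z *ᵥ p + V) (β • (Z *ᵥ p + V) + ε) β) =
    stat (√n • p) (ofSample Z ε V) := by
  set x := ofSample Z ε V with hx
  have hn' : (0 : ℝ) < n := Nat.cast_pos.2 hn
  have hS : Matrix.of x.1.2 = (n : ℝ)⁻¹ • (Zᵀ * Z) := rfl
  have hdet : (Zᵀ * Z).det ≠ 0 := fun h0 => h.2.2 (by
    rw [hS, Matrix.det_smul, h0, mul_zero])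
  have hψ0 : psi x 0 = (invSqrt (Zᵀ * Z) * Zᵀ) *ᵥ ε := psiMatrix_col_zero Z ε V
  have hψ1 : psi x 1 = (invSqrt (Zᵀ * Z) * Zᵀ) *ᵥ V := psiMatrix_col_one Z ε V
  have hproj : proj (√n • p) x = (invSqrt (Zᵀ * Z) * Zᵀ) *ᵥ (Z *ᵥ p + V) := by
    have hsymm : (1 / 2 : ℝ) • (Matrix.of x.1.2 + (Matrix.of x.1.2)ᵀ) = (n : ℝ)⁻¹ • (Zᵀ * Z) := by
      rw [hS, Matrix.transpose_smul, Matrix.transpose_mul, Matrix.transpose_transpose, ← two_smul ℝ,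
        smul_smul]
      norm_num
    rw [invSqrt_mul_transpose_mulVec hdet hn, proj, hsymm, hψ1]
  have hA : x.1.1.2 = fun a b =>
      ((n : ℝ)⁻¹ • !![ε ⬝ᵥ ε, ε ⬝ᵥ V; V ⬝ᵥ ε, V ⬝ᵥ V] : Matrix (Fin 2) (Fin 2) ℝ) a b := by
    rw [← transpose_errorMatrix_mul]
    rfl
  have hτ : x.2 = (n : ℝ)⁻¹ := rfl
  -- The annihilator kills the systematic part of X, so the residual form sees only the errors.
  have hMX : annZ Z *ᵥ (Z *ᵥ p + V) = annZ Z *ᵥ V := by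
    rw [Matrix.mulVec_add, Matrix.mulVec_mulVec, annZ_mul hdet, Matrix.zero_mulVec, zero_add]
  have hann := fun u v => dotProduct_annZ_mulVec hdet u v 0
  simp only [Matrix.mulVec_zero, zero_add] at hann
  have h00 : ε ⬝ᵥ annZ Z *ᵥ ε = n * resid x 0 0 := by
    rw [hann, resid, hψ0, hA, hτ]
    simp
    field_simp
  have h01 : ε ⬝ᵥ annZ Z *ᵥ (Z *ᵥ p + V) = n * resid x 0 1 := by
    rw [hMX, hann, resid, hψ0, hψ1, hA, hτ]
    simp
    field_simp
  have h11 : (Z *ᵥ p + V) ⬝ᵥ annZ Z *ᵥ (Z *ᵥ p + V) = n * resid x 1 1 := by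
    rw [hMX, dotProduct_mulVec_comm_of_transpose_eq (annZ_transpose Z), hMX, hann, resid, hψ1, hA,
      hτ]
    simp
    field_simp
  have hpos : 0 < n * resid x 0 0 := mul_pos hn' h.1
  have hschur : 0 < n * resid x 1 1 - (n * resid x 0 1) ^ 2 / (n * resid x 0 0) := by
    have e : n * resid x 1 1 - (n * resid x 0 1) ^ 2 / (n * resid x 0 0) =
        n * (resid x 1 1 - resid x 0 1 ^ 2 / resid x 0 0) := by
      have := h.1.ne'
      field_simp
    rw [e]
    exact mul_pos hn' (schur_pos h)
  rw [lambdaStat_lrStat_eq_statPair hkn Z _ ε β (dotProduct_projZ_mulVec hdet _ _)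
    (dotProduct_projZ_mulVec hdet _ _) (dotProduct_projZ_mulVec hdet _ _) h00 h01 h11 hpos hschur,
    statPair_mul hn'.ne', ← hψ0, ← hproj, stat, hτ]
  congr 1
  field_simp

end ModelState

end ModelState

/-! ### Convergence of the state -/

section Limit

variable {k : ℕ}

/-- The limiting state, as a function of two independent standard normal vectors. -/
noncomputable def limitState (B : Matrix (Fin 2) (Fin 2) ℝ) (Q : Matrix (Fin k) (Fin k) ℝ)
    (p : (Fin k → ℝ) × (Fin k → ℝ)) : ModelState k :=
  (((WithLp.toLp 2 fun a : Fin 2 × Fin k => B a.1 0 * p.1 a.2 + B a.1 1 * p.2 a.2, B * Bᵀ), Q), 0)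

theorem lowerTriangular_mul_transpose (α σ r : ℝ) :
    !![α, 0; r * α, σ] * !![α, 0; r * α, σ]ᵀ =
      !![α ^ 2, r * α ^ 2; r * α ^ 2, σ ^ 2 + r ^ 2 * α ^ 2] := by
  ext i j
  rw [Matrix.mul_apply, Fin.sum_univ_two]
  fin_cases i <;> fin_cases j <;> simp <;> ring

/-- Cholesky factorization: `r` is the regression coefficient of V on ε, and `σ ^ 2` is the Schur
complement. -/
theorem exists_lowerTriangular_mul_transpose {Om : Matrix (Fin 2) (Fin 2) ℝ} (hOm : Om.PosDef) :
    ∃ α σ r : ℝ, 0 < α ∧ 0 < σ ∧ Om = !![α, 0; r * α, σ] * !![α, 0; r * α, σ]ᵀ := by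
  have h00 : 0 < Om 0 0 := hOm.diag_pos
  have hdet := hOm.det_pos
  have hsymm : Om 1 0 = Om 0 1 := by simpa using hOm.isHermitian.apply 0 1
  rw [Matrix.det_fin_two, hsymm] at hdet
  have hs : 0 < Om 1 1 - Om 0 1 ^ 2 / Om 0 0 := by
    have e : Om 1 1 - Om 0 1 ^ 2 / Om 0 0 = (Om 0 0 * Om 1 1 - Om 0 1 * Om 0 1) / Om 0 0 := by
      field_simp
    rw [e]
    exact div_pos hdet h00
  refine ⟨√(Om 0 0), √(Om 1 1 - Om 0 1 ^ 2 / Om 0 0), Om 0 1 / Om 0 0, Real.sqrt_pos.2 h00,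
    Real.sqrt_pos.2 hs, ?_⟩
  have e1 := Real.sq_sqrt h00.le
  have e2 := Real.sq_sqrt hs.le
  have e3 : (Om 0 1 / Om 0 0) ^ 2 * Om 0 0 = Om 0 1 ^ 2 / Om 0 0 := by field_simp
  rw [lowerTriangular_mul_transpose, e1, e2, e3, div_mul_cancel₀ _ h00.ne', sub_add_cancel]
  ext i j
  fin_cases i <;> fin_cases j <;> simp [hsymm]

theorem limitState_mem_regular {Q : Matrix (Fin k) (Fin k) ℝ} (hQ : Q.PosDef) {α σ r : ℝ}
    (hα : 0 < α) (hσ : 0 < σ) (p : (Fin k → ℝ) × (Fin k → ℝ)) :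
    limitState !![α, 0; r * α, σ] Q p ∈ ModelState.regular k := by
  have hA : (limitState !![α, 0; r * α, σ] Q p).1.1.2 =
      !![α ^ 2, r * α ^ 2; r * α ^ 2, σ ^ 2 + r ^ 2 * α ^ 2] := lowerTriangular_mul_transpose α σ r
  have hτ : (limitState !![α, 0; r * α, σ] Q p).2 = 0 := rfl
  refine ⟨?_, ?_, hQ.det_pos.ne'⟩
  · simp [ModelState.resid, hA, hτ, hα]
  · simp only [ModelState.resid, hA, hτ, zero_mul, sub_zero]
    have : α ^ 2 * (σ ^ 2 + r ^ 2 * α ^ 2) - (r * α ^ 2) ^ 2 = α ^ 2 * σ ^ 2 := by ring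
    simpa [this] using mul_pos (pow_pos hα 2) (pow_pos hσ 2)

theorem stat_limitState {Q : Matrix (Fin k) (Fin k) ℝ} (hQ : Q.PosDef) (Pi₀ : Fin k → ℝ)
    {α σ r : ℝ} (hα : 0 < α) (hσ : 0 < σ) (p : (Fin k → ℝ) × (Fin k → ℝ)) :
    ModelState.stat Pi₀ (limitState !![α, 0; r * α, σ] Q p) =
      ((σ⁻¹ • cfc Real.sqrt Q *ᵥ Pi₀ + p.2) ⬝ᵥ (σ⁻¹ • cfc Real.sqrt Q *ᵥ Pi₀ + p.2),
        upperRoot (p.1 ⬝ᵥ p.1)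
          ((σ⁻¹ • cfc Real.sqrt Q *ᵥ Pi₀ + p.2) ⬝ᵥ (σ⁻¹ • cfc Real.sqrt Q *ᵥ Pi₀ + p.2))
          ((p.1 ⬝ᵥ (σ⁻¹ • cfc Real.sqrt Q *ᵥ Pi₀ + p.2)) ^ 2)) := by
  rw [← statPair_limit (r := r) hα.ne' hσ.ne']
  set x := limitState !![α, 0; r * α, σ] Q p with hx
  have hψ0 : ModelState.psi x 0 = α • p.1 := by
    ext i
    simp [hx, ModelState.psi, limitState]
  have hψ1 : ModelState.psi x 1 = r • α • p.1 + σ • p.2 := by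
    ext i
    simp [hx, ModelState.psi, limitState, mul_assoc]
  have hsymm : (1 / 2 : ℝ) • (Matrix.of x.1.2 + (Matrix.of x.1.2)ᵀ) = Q := by
    have h1 : (Matrix.of x.1.2 : Matrix (Fin k) (Fin k) ℝ) = Q := rfl
    have h2 : Qᵀ = Q := by
      rw [← Matrix.conjTranspose_eq_transpose_of_trivial]
      exact hQ.isHermitian
    rw [h1, h2, ← two_smul ℝ, smul_smul]
    norm_num
  have hproj : ModelState.proj Pi₀ x =
      r • α • p.1 + σ • (σ⁻¹ • cfc Real.sqrt Q *ᵥ Pi₀ + p.2) := by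
    rw [ModelState.proj, hsymm, hψ1, smul_add σ, smul_inv_smul₀ hσ.ne']
    abel
  have hτ : x.2 = 0 := rfl
  have hA : x.1.1.2 = !![α ^ 2, r * α ^ 2; r * α ^ 2, σ ^ 2 + r ^ 2 * α ^ 2] :=
    lowerTriangular_mul_transpose α σ r
  rw [ModelState.stat, hψ0, hproj]
  simp only [ModelState.resid, hτ, hA, zero_mul, mul_zero, sub_zero]
  rfl

/-- Joint convergence in distribution of the state of the samples. -/
theorem tendstoInDistribution_ofSample {Ω : Type*} [MeasurableSpace Ω] {P : Measure Ω}
    [IsProbabilityMeasure P] {Z : (n : ℕ) → Ω → Matrix (Fin n) (Fin k) ℝ}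
    {ε V : (n : ℕ) → Ω → Fin n → ℝ} (hZ : ∀ n i j, Measurable fun ω => Z n ω i j)
    (hε : ∀ n i, Measurable fun ω => ε n ω i) (hV : ∀ n i, Measurable fun ω => V n ω i)
    {B : Matrix (Fin 2) (Fin 2) ℝ} {Q : Matrix (Fin k) (Fin k) ℝ}
    (ha : ∀ a b, TendstoInMeasure P
      (fun (n : ℕ) ω => ((n : ℝ)⁻¹ •
        ((errorMatrix (ε n ω) (V n ω))ᵀ * errorMatrix (ε n ω) (V n ω))) a b)
      atTop (fun _ => (B * Bᵀ) a b))
    (hb : TendstoInDistribution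
      (fun n ω => WithLp.toLp 2 (psiMatrix (Z n ω) (ε n ω) (V n ω)).vec) atTop
      id (fun _ => P)
      (multivariateGaussian 0 ((B * Bᵀ) ⊗ₖ (1 : Matrix (Fin k) (Fin k) ℝ))))
    (hc : ∀ a b, TendstoInMeasure P
      (fun (n : ℕ) ω => ((n : ℝ)⁻¹ • ((Z n ω)ᵀ * Z n ω)) a b)
      atTop (fun _ => Q a b)) :
    TendstoInDistribution
      (fun n ω => ModelState.ofSample (Z n ω) (ε n ω) (V n ω)) atTop (limitState B Q)
      (fun _ => P) ((stdNormalPi (Fin k)).prod (stdNormalPi (Fin k))) := by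
  have hEm : ∀ (n : ℕ) a b, Measurable fun ω => ((n : ℝ)⁻¹ •
      ((errorMatrix (ε n ω) (V n ω))ᵀ * errorMatrix (ε n ω) (V n ω))) a b := fun n a b => by
    have he : ∀ i (c : Fin 2), Measurable fun ω => errorMatrix (ε n ω) (V n ω) i c := by
      intro i c
      fin_cases c
      · exact hε n i
      · exact hV n i
    exact (measurable_matrix_mul (fun i j => he j i) he a b).const_smul (n : ℝ)⁻¹
  have hSm : ∀ (n : ℕ) i j, Measurable fun ω => ((n : ℝ)⁻¹ • ((Z n ω)ᵀ * Z n ω)) i j :=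
    fun n i j =>
      (measurable_matrix_mul (fun i j => hZ n j i) (hZ n) i j).const_smul (n : ℝ)⁻¹
  have hE : TendstoInMeasure P (fun (n : ℕ) ω => (fun a b => ((n : ℝ)⁻¹ •
      ((errorMatrix (ε n ω) (V n ω))ᵀ * errorMatrix (ε n ω) (V n ω))) a b :
      Fin 2 → Fin 2 → ℝ)) atTop fun _ a b => (B * Bᵀ) a b :=
    tendstoInMeasure_pi (E := fun _ => Fin 2 → ℝ) fun a =>
      tendstoInMeasure_pi (E := fun _ => ℝ) fun b => ha a b
  have hS : TendstoInMeasure P (fun (n : ℕ) ω => (fun i j =>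
      ((n : ℝ)⁻¹ • ((Z n ω)ᵀ * Z n ω)) i j : Fin k → Fin k → ℝ)) atTop fun _ i j => Q i j :=
    tendstoInMeasure_pi (E := fun _ => Fin k → ℝ) fun i =>
      tendstoInMeasure_pi (E := fun _ => ℝ) fun j => hc i j
  have hτ : TendstoInMeasure P (fun (n : ℕ) (_ : Ω) => (n : ℝ)⁻¹) atTop fun _ => (0 : ℝ) :=
    tendstoInMeasure_of_tendsto_ae (fun _ => aestronglyMeasurable_const)
      (ae_of_all _ fun _ => tendsto_inv_atTop_nhds_zero_nat)
  have hΦ : Measurable fun p : (Fin k → ℝ) × (Fin k → ℝ) => (WithLp.toLp 2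
      fun a : Fin 2 × Fin k => B a.1 0 * p.1 a.2 + B a.1 1 * p.2 a.2 :
      EuclideanSpace ℝ (Fin 2 × Fin k)) := by fun_prop
  -- The Gaussian limit is realized through two independent standard normal vectors; the remaining
  -- components have constant limits and are adjoined by Slutsky's theorem.
  have hb' := hb.of_map_eq (P'' := (stdNormalPi (Fin k)).prod (stdNormalPi (Fin k)))
    hΦ.aemeasurable (Measure.map_id.trans (multivariateGaussian_kronecker_eq_map B))
  have h1 := hb'.prodMk_of_tendstoInMeasure_const _ _ _ hE fun n =>
    (measurable_pi_lambda _ fun a => measurable_pi_lambda _ fun b => hEm n a b).aemeasurable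
  have h2 := h1.prodMk_of_tendstoInMeasure_const _ _ _ hS fun n =>
    (measurable_pi_lambda _ fun i => measurable_pi_lambda _ fun j => hSm n i j).aemeasurable
  exact h2.prodMk_of_tendstoInMeasure_const _ _ _ hτ fun n => aemeasurable_const

end Limit

/-! ### The main theorem -/

theorem corollary1
    {Ω : Type*} [MeasurableSpace Ω] (P : Measure Ω) [IsProbabilityMeasure P]
    (k : ℕ)
    -- instruments, structural errors and first-stage errors, for each sample size `n`
    (Z : (n : ℕ) → Ω → Matrix (Fin n) (Fin k) ℝ)
    (ε V : (n : ℕ) → Ω → Fin n → ℝ)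
    (hZ : ∀ n i j, Measurable fun ω => Z n ω i j)
    (hε : ∀ n i, Measurable fun ω => ε n ω i)
    (hV : ∀ n i, Measurable fun ω => V n ω i)
    -- weak instruments: `√n Π = Π₀` is fixed and of full column rank `m = 1`
    (Pi₀ : Fin k → ℝ) (hPi₀ : Pi₀ ≠ 0)
    (Pi : ℕ → Fin k → ℝ) (hPi : ∀ n : ℕ, 0 < n → Real.sqrt n • Pi n = Pi₀)
    -- the model `X = Z Π + V`, `y = X β₀ + ε`
    (β₀ : ℝ) (X y : (n : ℕ) → Ω → Fin n → ℝ)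
    (hX : ∀ n ω, X n ω = Z n ω *ᵥ Pi n + V n ω)
    (hy : ∀ n ω, y n ω = β₀ • X n ω + ε n ω)
    -- the limit matrices
    (Om : Matrix (Fin 2) (Fin 2) ℝ) (hOm : Om.PosDef)
    (Q : Matrix (Fin k) (Fin k) ℝ) (hQ : Q.PosDef)
    -- (a) `(ε V)ᵀ (ε V) / n → Om` in probability
    (ha : ∀ a b, TendstoInMeasure P
      (fun (n : ℕ) ω => ((n : ℝ)⁻¹ •
        ((errorMatrix (ε n ω) (V n ω))ᵀ * errorMatrix (ε n ω) (V n ω))) a b)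
      atTop (fun _ => Om a b))
    -- (b) `vec Ψ → N(0, Om ⊗ Id)` in distribution
    (hb : TendstoInDistribution
      (fun n ω => WithLp.toLp 2 (psiMatrix (Z n ω) (ε n ω) (V n ω)).vec) atTop
      id (fun _ => P)
      (multivariateGaussian 0 (Om ⊗ₖ (1 : Matrix (Fin k) (Fin k) ℝ))))
    -- (c) `ZᵀZ / n → Q` in probability
    (hc : ∀ a b, TendstoInMeasure P
      (fun (n : ℕ) ω => ((n : ℝ)⁻¹ • ((Z n ω)ᵀ * Z n ω)) a b)
      atTop (fun _ => Q a b)) :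
    TendstoInDistributionGiven P
      (fun n ω => lrStat (Z n ω) (X n ω) (y n ω) β₀)
      (fun n ω => lambdaStat (Z n ω) (X n ω) (y n ω) β₀)
      (fun l q => gammaFun l q.1 q.2)
      ((chiSquared (k - 1)).prod (chiSquared 1)) := by
  -- A nonzero vector `Pi₀` exists only in positive dimension.
  have hk : 0 < k := by
    refine Nat.pos_of_ne_zero fun h => hPi₀ ?_
    subst h
    exact Subsingleton.elim _ _
  have hXm : ∀ n i, Measurable fun ω => X n ω i := fun n i => by
    have h : (fun ω => X n ω i) = fun ω => ∑ j, Z n ω i j * Pi n j + V n ω i :=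
      funext fun ω => by rw [hX]; rfl
    rw [h]
    exact (Finset.measurable_sum _ fun j _ => (hZ n i j).mul_const _).add (hV n i)
  have hym : ∀ n i, Measurable fun ω => y n ω i := fun n i => by
    have h : (fun ω => y n ω i) = fun ω => β₀ • X n ω i + ε n ω i :=
      funext fun ω => by rw [hy]; rfl
    rw [h]
    exact ((hXm n i).const_smul β₀).add (hε n i)
  have hL : ∀ n, Measurable fun ω => lambdaStat (Z n ω) (X n ω) (y n ω) β₀ := fun n =>
    measurable_lambdaStat (hZ n) (hXm n) (hym n) β₀
  have hT : ∀ n, Measurable fun ω => lrStat (Z n ω) (X n ω) (y n ω) β₀ := fun n =>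
    measurable_lrStat (hZ n) (hXm n) (hym n) β₀
  obtain ⟨α, σ, r, hα, hσ, rfl⟩ := exists_lowerTriangular_mul_transpose hOm
  set B : Matrix (Fin 2) (Fin 2) ℝ := !![α, 0; r * α, σ] with hB
  set m : Fin k → ℝ := σ⁻¹ • cfc Real.sqrt Q *ᵥ Pi₀ with hm
  have h3 := tendstoInDistribution_ofSample hZ hε hV ha hb hc
  have hstat : (fun p => ModelState.stat Pi₀ (limitState B Q p)) = _ :=
    funext fun p => stat_limitState hQ Pi₀ hα hσ p
  have hstatm : Measurable fun p => ModelState.stat Pi₀ (limitState B Q p) := by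
    have hc1 : Continuous fun p => ModelState.stat Pi₀ (limitState B Q p) :=
      (ModelState.continuousOn_stat Pi₀).comp_continuous
        (by unfold limitState; fun_prop) fun p => limitState_mem_regular hQ hα hσ p
    exact hc1.measurable
  have h4 : TendstoInDistribution (fun n ω => (lambdaStat (Z n ω) (X n ω) (y n ω) β₀,
      lrStat (Z n ω) (X n ω) (y n ω) β₀)) atTop
      (fun p => ModelState.stat Pi₀ (limitState B Q p)) (fun _ => P)
      ((stdNormalPi (Fin k)).prod (stdNormalPi (Fin k))) := by
    refine tendstoInDistribution_of_continuousOn h3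
      (fun n => ((hL n).prodMk (hT n)).aemeasurable) hstatm.aemeasurable
      (ModelState.stat Pi₀) ModelState.isOpen_regular (ModelState.continuousOn_stat Pi₀)
      (ae_of_all _ fun p => limitState_mem_regular hQ hα hσ p) (fun _ _ => rfl) ?_
    -- For `n ≥ k` the factor n - k is nonnegative and can be taken inside the square root.
    filter_upwards [eventually_ge_atTop k] with n hn ω hω
    have hn0 := hk.trans_le hn
    rw [hy, hX, ← hPi n hn0]
    exact ModelState.lambdaStat_lrStat_eq_stat hn0 hn _ _ _ _ _ hω
  have hl : Continuous fun z : Fin k → ℝ => (m + z) ⬝ᵥ (m + z) :=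
    continuous_dotProduct.comp (by fun_prop : Continuous fun z => (m + z, m + z))
  have hν : IsProbabilityMeasure
      ((stdNormalPi (Fin k)).map fun z => (m + z) ⬝ᵥ (m + z)) :=
    Measure.isProbabilityMeasure_map hl.measurable.aemeasurable
  refine tendstoInDistributionGiven_of_joint hL hT continuous_gammaFun
    continuous_gammaFun.measurable (map_stdNormalPi_sq_add_singleton hk m)
    (fun l₀ hl₀ δ hδ => map_stdNormalPi_sq_add_pos hk m hl₀ hδ) ?_
  refine h4.of_map_eq (measurable_fst.prodMk continuous_gammaFun.measurable).aemeasurable ?_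
  rw [hstat]
  exact map_prod_stdNormalPi_upperRoot hk m
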